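/- Work over $\mathbb{C}$. For an irreducible (closed, nonempty) projective variety $X\subset\mathbb{P}^n$, a hyperplane $H\subset\mathbb{P}^n$ is called tangent to $X$ if it contains the embedded projective tangent space $\hat T_xX$ at some smooth point $x$ of $X$. The dual variety $X^*\subset(\mathbb{P}^n)^*$ is the Zariski closure of the set of all hyperplanes tangent to $X$, and the defect of $X$ is $\operatorname{def}X=\operatorname{codim}_{(\mathbb{P}^n)^*}X^*-1=n-1-\dim X^*$, where $\dim\emptyset=-1$ (so $\operatorname{def}\mathbb{P}^n=n$). Theorem 6.5 (Product theorem). Let $X_1\subset\mathbb{P}^{n_1}$ and $X_2\subset\mathbb{P}^{n_2}$ be irreducible projective varieties, and regard $X_1\times X_2$ as a subvariety of $\mathbb{P}^n$, $n+1=(n_1+1)(n_2+1)$, by means of the Segre embedding $\mathbb{P}^{n_1}\times\mathbb{P}^{n_2}\subset\mathbb{P}^n$. Then $$\operatorname{def}(X_1\times X_2)=\max\bigl(0,\ \operatorname{def}X_1-\dim X_2,\ \operatorname{def}X_2-\dim X_1\bigr).$$ -/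

import Mathlib

noncomputable section

namespace ProjDual

/-- Complex projective space with homogeneous coordinates indexed by `ι`, that is, the set of
one-dimensional subspaces of `ι → ℂ`. For `ι = Fin (n + 1)` this is `ℙⁿ`. -/
abbrev ProjSpace (ι : Type) : Type := Projectivization ℂ (ι → ℂ)

variable {ι κ : Type}

/-- The common zero locus in projective space of a set of (homogeneous) polynomials. -/
def projZeros (S : Set (MvPolynomial ι ℂ)) : Set (ProjSpace ι) :=
  {p | ∀ f ∈ S, MvPolynomial.eval p.rep f = 0}

/-- A set is Zariski closed if it is the zero locus of a set of homogeneous polynomials. -/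
def IsZariskiClosed (Z : Set (ProjSpace ι)) : Prop :=
  ∃ S : Set (MvPolynomial ι ℂ), (∀ f ∈ S, ∃ d : ℕ, f.IsHomogeneous d) ∧ Z = projZeros S

theorem isZariskiClosed_empty : IsZariskiClosed (∅ : Set (ProjSpace ι)) := by
  refine ⟨{1}, ?_, ?_⟩
  · rintro f rfl
    exact ⟨0, MvPolynomial.isHomogeneous_one _ _⟩
  · ext p
    simp [projZeros]

theorem isZariskiClosed_sInter (A : Set (Set (ProjSpace ι)))
    (hA : ∀ Z ∈ A, IsZariskiClosed Z) : IsZariskiClosed (⋂₀ A) := by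
  choose! S hS hZ using hA
  refine ⟨⋃ Z ∈ A, S Z, ?_, ?_⟩
  · intro f hf
    simp only [Set.mem_iUnion] at hf
    obtain ⟨Z, hZA, hf⟩ := hf
    exact hS Z hZA f hf
  · ext p
    simp only [Set.mem_sInter, projZeros, Set.mem_iUnion, Set.mem_ofPred_eq]
    constructor
    · rintro h f ⟨Z, hZA, hf⟩
      have h1 := h Z hZA
      rw [hZ Z hZA] at h1
      exact h1 f hf
    · intro h Z hZA
      rw [hZ Z hZA]
      exact fun f hf => h f ⟨Z, hZA, hf⟩

theorem isZariskiClosed_union (Z W : Set (ProjSpace ι)) (hZ : IsZariskiClosed Z)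
    (hW : IsZariskiClosed W) : IsZariskiClosed (Z ∪ W) := by
  obtain ⟨S, hS, rfl⟩ := hZ
  obtain ⟨T, hT, rfl⟩ := hW
  refine ⟨Set.image2 (fun f g => f * g) S T, ?_, ?_⟩
  · rintro _ ⟨f, hf, g, hg, rfl⟩
    obtain ⟨d, hd⟩ := hS f hf
    obtain ⟨e, he⟩ := hT g hg
    exact ⟨d + e, hd.mul he⟩
  · ext p
    constructor
    · rintro (h | h) _ ⟨f, hf, g, hg, rfl⟩
      · simp [h f hf]
      · simp [h g hg]
    · intro h
      by_contra hn
      simp only [Set.mem_union, not_or, projZeros, Set.mem_ofPred_eq, not_forall] at hn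
      obtain ⟨⟨f, hf, hf0⟩, ⟨g, hg, hg0⟩⟩ := hn
      have h1 := h _ ⟨f, hf, g, hg, rfl⟩
      simp [hf0, hg0] at h1

/-- The Zariski topology on projective space. -/
instance zariskiTopology : TopologicalSpace (ProjSpace ι) :=
  TopologicalSpace.ofClosed {Z | IsZariskiClosed Z} isZariskiClosed_empty
    (fun A hA => isZariskiClosed_sInter A hA)
    (fun Z hZ W hW => isZariskiClosed_union Z W hZ hW)

/-- An irreducible projective variety in projective space: a nonempty irreducible Zariski closed
subset. -/
def IsIrredProjVariety (X : Set (ProjSpace ι)) : Prop :=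
  IsClosed X ∧ IsIrreducible X

/-- The dimension of a subset of projective space, i.e. the Krull dimension of its Zariski
topology, with the usual convention `dim ∅ = -1`. -/
def dim (Z : Set (ProjSpace ι)) : ℤ :=
  open Classical in
  if Z = ∅ then -1 else (((topologicalKrullDim Z).unbotD 0).toNat : ℤ)

/-- The affine cone over `X`: the union of the lines which are points of `X` (and the origin). -/
def cone (X : Set (ProjSpace ι)) : Set (ι → ℂ) :=
  {v | ∀ hv : v ≠ 0, Projectivization.mk ℂ v hv ∈ X}

/-- The Zariski tangent space at the vector `v` of the affine cone over `X`: the vectors killed by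
the differentials at `v` of all polynomials which vanish on the cone. Its projectivization is the
embedded projective tangent space of `X` at the point represented by `v`. -/
def coneTangentSpace [Fintype ι] (X : Set (ProjSpace ι)) (v : ι → ℂ) : Submodule ℂ (ι → ℂ) where
  carrier := {w | ∀ f ∈ MvPolynomial.vanishingIdeal ℂ (cone X),
    ∑ i, MvPolynomial.eval v (MvPolynomial.pderiv i f) * w i = 0}
  zero_mem' := by
    intro f _
    simp
  add_mem' := by
    intro a b ha hb f hf
    simp only [Pi.add_apply, mul_add, Finset.sum_add_distrib, ha f hf, hb f hf, add_zero]
  smul_mem' := by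
    intro c a ha f hf
    simp only [Pi.smul_apply, smul_eq_mul, mul_left_comm _ c, ← Finset.mul_sum, ha f hf, mul_zero]

/-- `x` is a smooth point of the irreducible projective variety `X`: the Zariski tangent space of
the cone over `X` at a nonzero vector of the line `x` has the dimension `dim X + 1` of the cone
(Jacobian criterion). -/
def IsSmoothPoint [Fintype ι] (X : Set (ProjSpace ι)) (x : ProjSpace ι) : Prop :=
  x ∈ X ∧ (Module.finrank ℂ (coneTangentSpace X x.rep) : ℤ) = dim X + 1

/-- The set of hyperplanes tangent to `X`, in the dual projective space. The point `H` of the dual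
space with homogeneous coordinates `a` is the hyperplane `∑ i, a i * z i = 0`; it is tangent to `X`
if it contains the embedded tangent space of `X` at some smooth point of `X`. -/
def tangentHyperplanes [Fintype ι] (X : Set (ProjSpace ι)) : Set (ProjSpace ι) :=
  {H | ∃ x, IsSmoothPoint X x ∧ ∀ w ∈ coneTangentSpace X x.rep, ∑ i, H.rep i * w i = 0}

/-- The dual variety: the Zariski closure of the set of all tangent hyperplanes. -/
def dualVariety [Fintype ι] (X : Set (ProjSpace ι)) : Set (ProjSpace ι) :=
  closure (tangentHyperplanes X)

/-- The codimension in a projective space with `n + 1` homogeneous coordinates: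
`codim Z = n - dim Z`. -/
def codim [Fintype ι] (Z : Set (ProjSpace ι)) : ℤ :=
  ((Fintype.card ι : ℤ) - 1) - dim Z

/-- The defect of `X`: the codimension of the dual variety, minus one. -/
def defect [Fintype ι] (X : Set (ProjSpace ι)) : ℤ :=
  codim (dualVariety X) - 1

theorem segre_ne_zero {v : ι → ℂ} {w : κ → ℂ} (hv : v ≠ 0) (hw : w ≠ 0) :
    (fun p : ι × κ => v p.1 * w p.2) ≠ 0 := by
  obtain ⟨i, hi⟩ := Function.ne_iff.mp hv
  obtain ⟨j, hj⟩ := Function.ne_iff.mp hw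
  exact Function.ne_iff.mpr ⟨(i, j), mul_ne_zero hi hj⟩

/-- The Segre embedding: the homogeneous coordinates of `segre x y` are all the pairwise products
of a homogeneous coordinate of `x` and one of `y`. -/
def segre (x : ProjSpace ι) (y : ProjSpace κ) : ProjSpace (ι × κ) :=
  Projectivization.mk ℂ (fun p : ι × κ => x.rep p.1 * y.rep p.2)
    (segre_ne_zero x.rep_nonzero y.rep_nonzero)

/-- The product `X₁ × X₂` of two projective varieties, embedded by the Segre embedding. -/
def segreProduct (X₁ : Set (ProjSpace ι)) (X₂ : Set (ProjSpace κ)) : Set (ProjSpace (ι × κ)) :=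
  Set.image2 segre X₁ X₂

end ProjDual

end

/-!
For an irreducible `X`, take a generic point `x` of the affine cone over `X`, with coordinates in an
extension field `F` of `ℂ` all of whose derivations are available: the vectors `D x`, for `D` a
derivation of `F`, fill the tangent space of the cone at `x`. A generic tangent hyperplane is a
generic vector `ξ` of the orthogonal complement of this space, and differentiating `ξ ⬝ᵥ D x = 0`
shows that the number of directions in which `ξ` moves modulo the complement is the rank of the
second fundamental form `(D, E) ↦ ξ ⬝ᵥ E (D x)`. Hence `def X = dim X - r`, where `r` is the largest
rank of the second fundamental forms at `x`.

At the point `x ⊗ y` of a Segre product, a conormal vector is a matrix `M` such that `M y` is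
conormal at `x` and `x M` is conormal at `y`, and its second fundamental form is the block matrix
`[[P, C], [Cᵀ, Q]]`, where `P` and `Q` are the forms of `X₁` and `X₂` for `M y` and `x M`, and `C`
can be prescribed arbitrarily. If `X₁` and `X₂` have dimensions `m` and `n` and maximal ranks `r₁`
and `r₂`, the largest rank of such a matrix is `min (m + n) (min (r₁ + 2 n) (r₂ + 2 m))`.
-/

noncomputable section

open MvPolynomial TensorProduct
open scoped Matrix

namespace ProjDual

/-! ### Derivations and tangent spaces -/

theorem formallySmooth_of_charZero (K L : Type*) [Field K] [CharZero K] [Field L] [Algebra K L] :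
    Algebra.FormallySmooth K L := by
  obtain ⟨ι, x, hx⟩ := exists_isTranscendenceBasis' K L
  have := hx.isAlgebraic_field
  exact .of_algebraicIndependent_of_isSeparable hx.1

theorem formallySmooth_of_injective {A F : Type*} [CommRing A] [IsDomain A] [CharZero A] [Field F]
    [Algebra A F] (hinj : Function.Injective (algebraMap A F)) : Algebra.FormallySmooth A F := by
  have : FaithfulSMul A F := (faithfulSMul_iff_algebraMap_injective A F).mpr hinj
  let := FractionRing.liftAlgebra A F
  have := FractionRing.isScalarTower_liftAlgebra A F
  have : CharZero (FractionRing A) :=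
    charZero_of_injective_algebraMap (IsFractionRing.injective A (FractionRing A))
  have := formallySmooth_of_charZero (FractionRing A) F
  have : Algebra.FormallySmooth A (FractionRing A) := .of_isLocalization (nonZeroDivisors A)
  exact .comp A (FractionRing A) F

theorem injective_mapBaseChange_of_formallySmooth (k A F : Type*) [CommRing k] [CommRing A]
    [CommRing F] [Algebra k A] [Algebra k F] [Algebra A F] [IsScalarTower k A F]
    [Algebra.FormallySmooth A F] :
    Function.Injective (KaehlerDifferential.mapBaseChange k A F) := by
  refine (injective_iff_map_eq_zero _).mpr fun a ha => ?_
  obtain ⟨b, rfl⟩ := (Algebra.H1Cotangent.exact_δ_mapBaseChange k A F a).mp ha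
  rw [Subsingleton.elim b 0, map_zero]

theorem exists_derivation_extending {k A F : Type*} [CommRing k] [CommRing A] [IsDomain A]
    [CharZero A] [Field F] [Algebra k A] [Algebra k F] [Algebra A F] [IsScalarTower k A F]
    (hinj : Function.Injective (algebraMap A F)) (d : Derivation k A F) :
    ∃ D : Derivation k F F, ∀ a, D (algebraMap A F a) = d a := by
  have := formallySmooth_of_injective hinj
  obtain ⟨g, hg⟩ := LinearMap.exists_leftInverse_of_injective
    (KaehlerDifferential.mapBaseChange k A F)
    (LinearMap.ker_eq_bot.mpr (injective_mapBaseChange_of_formallySmooth k A F))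
  let l : F ⊗[A] Ω[A⁄k] →ₗ[F] F := LinearMap.liftBaseChange F d.liftKaehlerDifferential
  refine ⟨(l ∘ₗ g).compDer (KaehlerDifferential.D k F), fun a => ?_⟩
  have hga : g (KaehlerDifferential.D k F (algebraMap A F a)) =
      1 ⊗ₜ KaehlerDifferential.D k A a := by
    simpa using LinearMap.congr_fun hg (1 ⊗ₜ KaehlerDifferential.D k A a)
  simp [hga, l]

theorem exists_derivation_of_surjective {k P A M : Type*} [CommRing k] [CommRing P] [CommRing A]
    [AddCommGroup M] [Algebra k P] [Algebra k A] [Algebra P A] [IsScalarTower k P A] [Module k M]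
    [Module P M] [Module A M] [IsScalarTower P A M]
    (hsurj : Function.Surjective (algebraMap P A)) (δ : Derivation k P M)
    (hδ : ∀ p, algebraMap P A p = 0 → δ p = 0) :
    ∃ d : Derivation k A M, ∀ p, d (algebraMap P A p) = δ p := by
  have hδ' (p q : P) (h : algebraMap P A p = algebraMap P A q) : δ p = δ q := by
    rw [← sub_eq_zero, ← map_sub]
    exact hδ _ (by rw [map_sub, h, sub_self])
  choose s hs using hsurj
  let L : A →ₗ[k] M :=
    { toFun := fun a => δ (s a)
      map_add' := fun a b => by rw [← map_add]; exact hδ' _ _ (by simp [hs])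
      map_smul' := fun c a => by
        rw [RingHom.id_apply, ← δ.map_smul]
        exact hδ' _ _ (by
          rw [hs]; exact ((map_smul (IsScalarTower.toAlgHom k P A) c (s a)).trans
            (congrArg (c • ·) (hs a))).symm) }
  have hL (p : P) : L (algebraMap P A p) = δ p := hδ' _ _ (hs _)
  refine ⟨Derivation.mk' L fun a b => ?_, hL⟩
  rw [← hs a, ← hs b, ← map_mul, hL, hL, hL, δ.leibniz, algebraMap_smul, algebraMap_smul]

theorem exists_derivation_of_ker {k P F : Type*} [Field k] [CharZero k] [CommRing P] [Field F]
    [Algebra k P] [Algebra k F] [Algebra P F] [IsScalarTower k P F] (δ : Derivation k P F)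
    (hδ : ∀ p, algebraMap P F p = 0 → δ p = 0) :
    ∃ D : Derivation k F F, ∀ p, D (algebraMap P F p) = δ p := by
  let φ := IsScalarTower.toAlgHom k P F
  let _ : Algebra P φ.range := φ.rangeRestrict.toAlgebra
  have : IsScalarTower k P φ.range := .of_algebraMap_eq fun c => Subtype.ext (φ.commutes c).symm
  have : IsScalarTower P φ.range F := .of_algebraMap_eq fun _ => rfl
  have : CharZero φ.range := charZero_of_injective_algebraMap (algebraMap k _).injective
  obtain ⟨d, hd⟩ := exists_derivation_of_surjective (A := φ.range) φ.rangeRestrict_surjective δ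
    fun p hp => hδ p (congrArg Subtype.val hp)
  obtain ⟨D, hD⟩ := exists_derivation_extending (A := φ.range) Subtype.val_injective d
  exact ⟨D, fun p => (hD _).trans (hd p)⟩

/-- The field of constants of a derivation. -/
def constants {k F : Type*} [Field k] [Field F] [Algebra k F] (D : Derivation k F F) :
    IntermediateField k F where
  carrier := {a | D a = 0}
  mul_mem' {a b} ha hb := by simp [Set.mem_ofPred_eq.mp ha, Set.mem_ofPred_eq.mp hb]
  add_mem' {a b} ha hb := by simp [Set.mem_ofPred_eq.mp ha, Set.mem_ofPred_eq.mp hb]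
  algebraMap_mem' c := D.map_algebraMap c
  inv_mem' a ha := by simp [D.leibniz_inv, Set.mem_ofPred_eq.mp ha]

theorem derivation_eq_zero_of_isAlgebraic {K F : Type*} [Field K] [CharZero K] [Field F]
    [Algebra K F] (D : Derivation K F F) {a : F} (ha : IsAlgebraic K a) : D a = 0 := by
  have hsep := (minpoly.irreducible ha.isIntegral).separable.aeval_derivative_ne_zero
    (minpoly.aeval K a)
  have h := D.map_aeval (minpoly K a) a
  rw [minpoly.aeval, map_zero, smul_eq_mul, eq_comm, mul_eq_zero] at h
  exact h.resolve_left hsep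

theorem mem_constants_of_isAlgebraic {k F : Type*} [Field k] [CharZero k] [Field F] [Algebra k F]
    (D : Derivation k F F) {a : F} (ha : IsAlgebraic (constants D) a) : a ∈ constants D :=
  let D' : Derivation (constants D) F F := Derivation.mk'
    { toFun := D
      map_add' := map_add D
      map_smul' := fun c b => by
        have hc : D c = 0 := c.2
        simp [IntermediateField.smul_def, hc] }
    D.leibniz
  derivation_eq_zero_of_isAlgebraic D' ha

section TangentSpace

variable (k : Type*) {ι κ F : Type*} [Field k] [Field F] [Algebra k F]

/-- Derivations of `F` act on the tuples of elements of `F`, coordinate by coordinate. -/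
def evalDer (x : ι → F) : Derivation k F F →ₗ[F] (ι → F) where
  toFun D i := D (x i)
  map_add' _ _ := rfl
  map_smul' _ _ := rfl

/-- The tangent space at an `F`-valued point `x` of affine space of the smallest `k`-variety which
contains `x`: in characteristic zero it consists of the derivatives of `x`, see
`mem_tangentSpace_iff`. -/
def tangentSpace (x : ι → F) : Submodule F (ι → F) := LinearMap.range (evalDer k x)

variable {k}

/-- The gradient of a polynomial at `x`. -/
def grad (f : MvPolynomial ι k) (x : ι → F) : ι → F := fun i => aeval x (pderiv i f)

theorem derivation_eq_sum_pderiv [Fintype ι] {M : Type*} [AddCommGroup M] [Module k M]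
    [Module (MvPolynomial ι k) M] [IsScalarTower k (MvPolynomial ι k) M]
    (δ : Derivation k (MvPolynomial ι k) M) (f : MvPolynomial ι k) :
    δ f = ∑ i, pderiv i f • δ (X i) := by
  classical
  have hsum (D : ι → Derivation k (MvPolynomial ι k) M) (g : MvPolynomial ι k) :
      (∑ i, D i) g = ∑ i, D i g := by
    rw [← Derivation.coeFnAddMonoidHom_apply, map_sum, Finset.sum_apply]
    rfl
  have h : δ = ∑ i, (LinearMap.toSpanSingleton _ M (δ (X i))).compDer (pderiv i) :=
    derivation_ext fun j => by simp [hsum, pderiv_X, Pi.single_apply, ite_smul]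
  conv_lhs => rw [h]
  simp [hsum]

theorem derivation_aeval [Fintype ι] (D : Derivation k F F) (x : ι → F) (f : MvPolynomial ι k) :
    D (aeval x f) = grad f x ⬝ᵥ evalDer k x D := by
  let _ : Algebra (MvPolynomial ι k) F := (aeval x).toAlgebra
  have : IsScalarTower k (MvPolynomial ι k) F := .of_algHom (aeval x)
  have h := derivation_eq_sum_pderiv (D.compAlgebraMap (MvPolynomial ι k)) f
  simpa [dotProduct, grad, evalDer, Algebra.smul_def, RingHom.algebraMap_toAlgebra] using h

theorem mem_tangentSpace_iff [CharZero k] [Fintype ι] {x w : ι → F} :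
    w ∈ tangentSpace k x ↔ ∀ f : MvPolynomial ι k, aeval x f = 0 → grad f x ⬝ᵥ w = 0 := by
  constructor
  · rintro ⟨D, rfl⟩ f hf
    rw [← derivation_aeval, hf, map_zero]
  · intro h
    let _ : Algebra (MvPolynomial ι k) F := (aeval x).toAlgebra
    have : IsScalarTower k (MvPolynomial ι k) F := .of_algHom (aeval x)
    have hδ (f : MvPolynomial ι k) : mkDerivation k w f = grad f x ⬝ᵥ w := by
      simp [derivation_eq_sum_pderiv (mkDerivation k w) f, dotProduct, grad, Algebra.smul_def,
        RingHom.algebraMap_toAlgebra]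
    obtain ⟨D, hD⟩ := exists_derivation_of_ker (mkDerivation k w)
      fun f hf => (hδ f).trans (h f hf)
    refine ⟨D, funext fun i => ?_⟩
    simpa [RingHom.algebraMap_toAlgebra, evalDer] using hD (X i)

theorem tangentSpace_eq_top [CharZero k] [Finite ι] {t : ι → F}
    (ht : AlgebraicIndependent k t) :
    tangentSpace k t = ⊤ := by
  have := Fintype.ofFinite ι
  refine eq_top_iff.mpr fun w _ => mem_tangentSpace_iff.mpr fun f hf => ?_
  rw [(injective_iff_map_eq_zero _).mp ht f hf]
  simp [grad, dotProduct]

theorem ker_evalDer_le_of_isAlgebraic [CharZero k] {x : ι → F} {t : κ → F}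
    (h : ∀ i, IsAlgebraic (aeval t : MvPolynomial κ k →ₐ[k] F).range (x i)) :
    LinearMap.ker (evalDer k t) ≤ LinearMap.ker (evalDer k x) := by
  intro D hD
  have hle : (aeval t : MvPolynomial κ k →ₐ[k] F).range ≤ (constants D).toSubalgebra := by
    rw [← Algebra.adjoin_range_eq_range_aeval]
    exact Algebra.adjoin_le (Set.range_subset_iff.mpr (congrFun (LinearMap.mem_ker.mp hD)))
  exact funext fun i => mem_constants_of_isAlgebraic D ((h i).tower_top_of_subalgebra_le hle)

theorem finrank_tangentSpace_of_isAlgebraic [CharZero k] [Fintype κ] {x : ι → F} {t : κ → F}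
    (ht : AlgebraicIndependent k t)
    (hx : ∀ i, IsAlgebraic (aeval t : MvPolynomial κ k →ₐ[k] F).range (x i))
    (htx : ∀ j, IsAlgebraic (aeval x : MvPolynomial ι k →ₐ[k] F).range (t j)) :
    Module.finrank F (tangentSpace k x) = Fintype.card κ := by
  have hker : LinearMap.ker (evalDer k x) = LinearMap.ker (evalDer k t) :=
    (ker_evalDer_le_of_isAlgebraic htx).antisymm (ker_evalDer_le_of_isAlgebraic hx)
  have h := (LinearMap.quotKerEquivRange (evalDer k x)).finrank_eq
  rw [hker, (LinearMap.quotKerEquivRange (evalDer k t)).finrank_eq] at h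
  change Module.finrank F (tangentSpace k t) = _ at h
  rw [tangentSpace, ← h, tangentSpace_eq_top ht, finrank_top, Module.finrank_fintype_fun_eq_card]

end TangentSpace

theorem ringKrullDim_eq_of_isIntegral {R S : Type*} [CommRing R] [CommRing S] [Algebra R S]
    [Algebra.IsIntegral R S] (h : Function.Injective (algebraMap R S)) :
    ringKrullDim S = ringKrullDim R := by
  have : FaithfulSMul R S := (faithfulSMul_iff_algebraMap_injective R S).mpr h
  refine le_antisymm ?_ (iSup_le fun l => ?_)
  · exact Order.krullDim_le_of_strictMono (PrimeSpectrum.comap (algebraMap R S))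
      fun _ _ hpq => Ideal.IsIntegral.comap_lt_comap hpq
  · obtain ⟨Q, hQ⟩ := Algebra.IsIntegral.comap_surjective R S l.head
    have : Q.asIdeal.LiesOver l.head.asIdeal := ⟨congrArg PrimeSpectrum.asIdeal hQ.symm⟩
    obtain ⟨L, hL, -⟩ := Ideal.exists_ltSeries_of_hasGoingUp l Q.asIdeal
    exact hL ▸ Order.LTSeries.length_le_krullDim L

theorem ringKrullDim_quotient_ker_aeval {k ι F : Type*} [Field k] [CharZero k] [Finite ι] [Field F]
    [Algebra k F] (x : ι → F) :
    ringKrullDim (MvPolynomial ι k ⧸ RingHom.ker (aeval x : MvPolynomial ι k →ₐ[k] F)) =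
      Module.finrank F (tangentSpace k x) := by
  let A := (aeval x : MvPolynomial ι k →ₐ[k] F).range
  have : Algebra.FiniteType k A :=
    .of_surjective (aeval x : MvPolynomial ι k →ₐ[k] F).rangeRestrict
      (AlgHom.rangeRestrict_surjective _)
  obtain ⟨s, g, hg, hgi⟩ := exists_integral_inj_algHom_of_fg k A
  let t : Fin s → F := fun j => g (X j)
  have htg : aeval t = A.val.comp g := algHom_ext fun j => by simp [t]
  have ht : AlgebraicIndependent k t := by
    rw [AlgebraicIndependent, htg]
    exact Subtype.val_injective.comp hg
  let _ : Algebra (MvPolynomial (Fin s) k) A := g.toRingHom.toAlgebra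
  have hint : Algebra.IsIntegral (MvPolynomial (Fin s) k) A := ⟨hgi⟩
  have hx (i : ι) : IsAlgebraic (aeval t : MvPolynomial (Fin s) k →ₐ[k] F).range (x i) :=
    ((hint.isIntegral ⟨x i, X i, by simp⟩).map_of_comp_eq (aeval t).rangeRestrict.toRingHom
      A.val.toRingHom (congrArg AlgHom.toRingHom htg)).isAlgebraic
  have htx (j : Fin s) : IsAlgebraic A (t j) := isAlgebraic_algebraMap (g (X j))
  calc ringKrullDim (MvPolynomial ι k ⧸ RingHom.ker (aeval x : MvPolynomial ι k →ₐ[k] F))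
      = ringKrullDim A := ringKrullDim_eq_of_ringEquiv
        (RingHom.quotientKerEquivRange (aeval x : MvPolynomial ι k →ₐ[k] F).toRingHom)
    _ = ringKrullDim (MvPolynomial (Fin s) k) := ringKrullDim_eq_of_isIntegral hg
    _ = Module.finrank F (tangentSpace k x) := by
      rw [finrank_tangentSpace_of_isAlgebraic ht hx htx, ringKrullDim_of_isNoetherianRing,
        ringKrullDim_eq_zero_of_field, zero_add, Nat.card_eq_fintype_card]

/-! ### Dimension of a projective variety -/

section Cone

variable {ι : Type} {F : Type*} [Field F] [Algebra ℂ F] {Z : Set (ProjSpace ι)}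
  {f : MvPolynomial ι ℂ} {n : ℕ}

theorem isClosed_iff_isZariskiClosed : IsClosed Z ↔ IsZariskiClosed Z := by
  rw [← isOpen_compl_iff]
  change Zᶜᶜ ∈ {Z | IsZariskiClosed Z} ↔ _
  simp

theorem isClosed_projZeros_singleton (hf : f.IsHomogeneous n) : IsClosed (projZeros {f}) :=
  isClosed_iff_isZariskiClosed.mpr ⟨{f}, by rintro _ rfl; exact ⟨n, hf⟩, rfl⟩

theorem subset_projZeros_singleton : Z ⊆ projZeros {f} ↔ ∀ p ∈ Z, eval p.rep f = 0 := by
  simp [projZeros, Set.subset_def]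

theorem cone_mono {W : Set (ProjSpace ι)} (h : Z ⊆ W) : cone Z ⊆ cone W :=
  fun _ hv hv0 => h (hv hv0)

theorem cone_empty : cone (∅ : Set (ProjSpace ι)) = {0} := by
  ext v
  simp [cone]

theorem rep_mem_cone_iff {p : ProjSpace ι} : p.rep ∈ cone Z ↔ p ∈ Z :=
  ⟨fun h => by simpa using h p.rep_nonzero, fun h _ => by simpa using h⟩

theorem smul_mem_cone {v : ι → ℂ} (hv : v ∈ cone Z) (c : ℂ) : c • v ∈ cone Z := by
  intro hcv
  obtain ⟨-, hv0⟩ := smul_ne_zero_iff.mp hcv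
  convert hv hv0 using 1
  exact (Projectivization.mk_eq_mk_iff' ℂ _ _ _ _).mpr ⟨c, rfl⟩

theorem exists_eq_smul_rep_of_mem_cone (hZ : Z.Nonempty) {v : ι → ℂ} (hv : v ∈ cone Z) :
    ∃ p ∈ Z, ∃ c : ℂ, v = c • p.rep := by
  obtain ⟨q, hq⟩ := hZ
  by_cases hv0 : v = 0
  · exact ⟨q, hq, 0, by simp [hv0]⟩
  · obtain ⟨a, ha⟩ := Projectivization.exists_smul_eq_mk_rep ℂ v hv0
    exact ⟨_, hv hv0, (a⁻¹ : ℂˣ), by rw [← ha, ← Units.smul_def, inv_smul_smul]⟩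

theorem aeval_smul_of_isHomogeneous (hf : f.IsHomogeneous n) (c : F) (x : ι → F) :
    aeval (c • x) f = c ^ n * aeval x f := by
  simp only [aeval_def, eval₂_eq, Finset.mul_sum]
  refine Finset.sum_congr rfl fun d hd => ?_
  simp only [Pi.smul_apply, smul_eq_mul, mul_pow, Finset.prod_mul_distrib,
    Finset.prod_pow_eq_pow_sum, hf.degree_eq_sum_deg_support hd]
  ring

theorem eval_smul_of_isHomogeneous (hf : f.IsHomogeneous n) (c : ℂ) (x : ι → ℂ) :
    eval (c • x) f = c ^ n * eval x f := by
  simpa [coe_aeval_eq_eval] using aeval_smul_of_isHomogeneous hf c x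

/-- The homogeneous ideal of a set of points of projective space: the ideal of its affine cone. -/
abbrev coneIdeal (Z : Set (ProjSpace ι)) : Ideal (MvPolynomial ι ℂ) := vanishingIdeal ℂ (cone Z)

theorem mem_coneIdeal_iff : f ∈ coneIdeal Z ↔ ∀ v ∈ cone Z, eval v f = 0 := by
  simp [mem_vanishingIdeal_iff]

theorem eval_rep_of_mem_coneIdeal (hf : f ∈ coneIdeal Z) {p : ProjSpace ι} (hp : p ∈ Z) :
    eval p.rep f = 0 :=
  mem_coneIdeal_iff.mp hf _ (rep_mem_cone_iff.mpr hp)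

theorem coneIdeal_anti {W : Set (ProjSpace ι)} (h : Z ⊆ W) : coneIdeal W ≤ coneIdeal Z :=
  vanishingIdeal_anti_mono (cone_mono h)

theorem mem_coneIdeal_empty : f ∈ coneIdeal (∅ : Set (ProjSpace ι)) ↔ eval 0 f = 0 := by
  simp [cone_empty]

theorem coneIdeal_ne_top (Z : Set (ProjSpace ι)) : coneIdeal Z ≠ ⊤ := by
  rw [Ideal.ne_top_iff_one, mem_coneIdeal_iff]
  exact fun h => by simpa using h 0 fun h0 => absurd rfl h0

theorem mem_coneIdeal_iff_of_isHomogeneous (hZ : Z.Nonempty) (hf : f.IsHomogeneous n) :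
    f ∈ coneIdeal Z ↔ Z ⊆ projZeros {f} := by
  rw [subset_projZeros_singleton]
  refine ⟨fun h p hp => eval_rep_of_mem_coneIdeal h hp, fun h => mem_coneIdeal_iff.mpr ?_⟩
  intro v hv
  obtain ⟨p, hp, c, rfl⟩ := exists_eq_smul_rep_of_mem_cone hZ hv
  rw [eval_smul_of_isHomogeneous hf, h p hp, mul_zero]

theorem homogeneousComponent_mem_coneIdeal (hf : f ∈ coneIdeal Z) (n : ℕ) :
    homogeneousComponent n f ∈ coneIdeal Z := by
  rw [mem_coneIdeal_iff] at hf ⊢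
  intro v hv
  -- `t ↦ f (t • v)` is a polynomial function which vanishes identically
  let P : Polynomial ℂ := ∑ k ∈ Finset.range (f.totalDegree + 1),
    Polynomial.monomial k (eval v (homogeneousComponent k f))
  have hP : P = 0 := by
    refine Polynomial.funext fun t => ?_
    rw [Polynomial.eval_zero, ← hf _ (smul_mem_cone hv t)]
    conv_rhs => rw [← sum_homogeneousComponent f]
    simp only [P, Polynomial.eval_finsetSum, Polynomial.eval_monomial, map_sum]
    refine Finset.sum_congr rfl fun k _ => ?_
    rw [eval_smul_of_isHomogeneous (homogeneousComponent_isHomogeneous k f), mul_comm]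
  by_cases hn : f.totalDegree < n
  · simp [homogeneousComponent_eq_zero _ _ hn]
  · have := congrArg (Polynomial.coeff · n) hP
    simpa [P, Polynomial.coeff_monomial, Nat.lt_succ_iff, not_lt.mp hn] using this

theorem mem_coneIdeal_iff_homogeneousComponent :
    f ∈ coneIdeal Z ↔ ∀ n, homogeneousComponent n f ∈ coneIdeal Z := by
  refine ⟨homogeneousComponent_mem_coneIdeal, fun h => ?_⟩
  rw [← sum_homogeneousComponent f]
  exact Ideal.sum_mem _ fun n _ => h n

theorem coneIdeal_closure (Z : Set (ProjSpace ι)) : coneIdeal (closure Z) = coneIdeal Z := by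
  obtain rfl | hZ := Z.eq_empty_or_nonempty
  · rw [closure_empty]
  ext f
  rw [mem_coneIdeal_iff_homogeneousComponent,
    mem_coneIdeal_iff_homogeneousComponent (Z := Z)]
  refine forall_congr' fun n => ?_
  have hn := homogeneousComponent_isHomogeneous n f
  rw [mem_coneIdeal_iff_of_isHomogeneous hZ.closure hn, mem_coneIdeal_iff_of_isHomogeneous hZ hn,
    (isClosed_projZeros_singleton hn).closure_subset_iff]

theorem mem_of_forall_eval_rep_eq_zero (hZ : IsClosed Z) {p : ProjSpace ι}
    (h : ∀ f ∈ coneIdeal Z, eval p.rep f = 0) : p ∈ Z := by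
  obtain rfl | hne := Z.eq_empty_or_nonempty
  · exact absurd (funext fun i => by simpa using h (X i) (by simp [cone_empty]))
      p.rep_nonzero
  · obtain ⟨S, hS, rfl⟩ := isClosed_iff_isZariskiClosed.mp hZ
    intro s hs
    obtain ⟨d, hd⟩ := hS s hs
    exact h s ((mem_coneIdeal_iff_of_isHomogeneous hne hd).mpr
      (subset_projZeros_singleton.mpr fun q hq => hq s hs))

theorem coneIdeal_lt_coneIdeal {W : Set (ProjSpace ι)} (hZ : IsClosed Z) (h : Z ⊂ W) :
    coneIdeal W < coneIdeal Z :=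
  ⟨coneIdeal_anti h.1, fun hle => h.2 fun _ hp => mem_of_forall_eval_rep_eq_zero hZ fun _ hf =>
    eval_rep_of_mem_coneIdeal (hle hf) hp⟩

attribute [local instance] MvPolynomial.gradedAlgebra in
theorem isPrime_coneIdeal_of_homogeneous
    (h : ∀ {f g : MvPolynomial ι ℂ} {m n : ℕ}, f.IsHomogeneous m → g.IsHomogeneous n →
      f * g ∈ coneIdeal Z → f ∈ coneIdeal Z ∨ g ∈ coneIdeal Z) :
    (coneIdeal Z).IsPrime := by
  have hom : (coneIdeal Z).IsHomogeneous (homogeneousSubmodule ι ℂ) := fun n f hf => by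
    have h := homogeneousComponent_mem_coneIdeal hf n
    rwa [← decomposition.decompose'_apply] at h
  exact hom.isPrime_of_homogeneous_mem_or_mem (coneIdeal_ne_top Z)
    fun ⟨_, hm⟩ ⟨_, hn⟩ => h hm hn

theorem isPrime_coneIdeal (hZ : IsPreirreducible Z) : (coneIdeal Z).IsPrime := by
  refine isPrime_coneIdeal_of_homogeneous fun {f g m n} hf hg hfg => ?_
  obtain rfl | hne := Z.eq_empty_or_nonempty
  · simpa only [mem_coneIdeal_empty, map_mul, mul_eq_zero] using hfg
  rw [mem_coneIdeal_iff_of_isHomogeneous hne hf, mem_coneIdeal_iff_of_isHomogeneous hne hg]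
  refine isPreirreducible_iff_isClosed_union_isClosed.mp hZ _ _
    (isClosed_projZeros_singleton hf) (isClosed_projZeros_singleton hg) fun p hp => ?_
  simpa [projZeros] using eval_rep_of_mem_coneIdeal hfg hp

theorem isPreirreducible_of_isPrime_coneIdeal (h : (coneIdeal Z).IsPrime) :
    IsPreirreducible Z := by
  refine isPreirreducible_iff_isClosed_union_isClosed.mpr fun A B hA hB hZ => ?_
  by_contra! hn
  obtain ⟨⟨p, hpZ, hpA⟩, q, hqZ, hqB⟩ :=
    hn.imp Set.not_subset.mp Set.not_subset.mp
  obtain ⟨S, hS, rfl⟩ := isClosed_iff_isZariskiClosed.mp hA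
  obtain ⟨T, hT, rfl⟩ := isClosed_iff_isZariskiClosed.mp hB
  simp only [projZeros, Set.mem_ofPred_eq, not_forall] at hpA hqB
  obtain ⟨s, hs, hps⟩ := hpA
  obtain ⟨t, ht, hqt⟩ := hqB
  obtain ⟨m, hm⟩ := hS s hs
  obtain ⟨n, hn⟩ := hT t ht
  have hst : s * t ∈ coneIdeal Z := by
    refine (mem_coneIdeal_iff_of_isHomogeneous ⟨p, hpZ⟩ (hm.mul hn)).mpr
      (subset_projZeros_singleton.mpr fun z hz => ?_)
    rw [map_mul, mul_eq_zero]
    exact (hZ hz).imp (fun h => h s hs) fun h => h t ht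
  exact (h.mem_or_mem hst).elim (fun hs => hps (eval_rep_of_mem_coneIdeal hs hpZ))
    fun ht => hqt (eval_rep_of_mem_coneIdeal ht hqZ)

end Cone

section Dimension

theorem isPreirreducible_preimage_val {X : Type*} [TopologicalSpace X] {C Z : Set X}
    (hC : IsPreirreducible C) (hCZ : C ⊆ Z) :
    IsPreirreducible (Subtype.val ⁻¹' C : Set Z) := by
  rintro _ _ ⟨u, hu, rfl⟩ ⟨v, hv, rfl⟩ ⟨x, hxC, hxu⟩ ⟨y, hyC, hyv⟩
  obtain ⟨z, hzC, hz⟩ := hC u v hu hv ⟨x, hxC, hxu⟩ ⟨y, hyC, hyv⟩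
  exact ⟨⟨z, hCZ hzC⟩, hzC, hz⟩

open TopologicalSpace in
theorem topologicalKrullDim_eq_krullDim_of_isClosed {X : Type*} [TopologicalSpace X] {Z : Set X}
    (hZ : IsClosed Z) :
    topologicalKrullDim Z = Order.krullDim {C : IrreducibleCloseds X // (C : Set X) ⊆ Z} := by
  refine le_antisymm ?_ ?_
  · refine Order.krullDim_le_of_strictMono (fun C => ⟨C.map _ continuous_subtype_val,
      closure_minimal (Subtype.coe_image_subset Z C) hZ⟩) fun C D h => ?_
    exact IrreducibleCloseds.map_strictMono_of_isInducing Topology.IsInducing.subtypeVal h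
  · refine Order.krullDim_le_of_strictMono (fun C => ⟨Subtype.val ⁻¹' (C : Set X), ⟨?_, ?_⟩,
      C.1.isClosed.preimage continuous_subtype_val⟩) fun C D h => ?_
    · obtain ⟨x, hx⟩ := C.1.isIrreducible.nonempty
      exact ⟨⟨x, C.2 hx⟩, hx⟩
    · exact isPreirreducible_preimage_val C.1.isIrreducible.isPreirreducible C.2
    · exact ⟨fun x hx => h.1 hx, fun hle => h.2 fun x hx => @hle ⟨x, D.2 hx⟩ hx⟩

variable {ι : Type} {Z : Set (ProjSpace ι)} {I J : Ideal (MvPolynomial ι ℂ)} {i : ι}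
  {f : MvPolynomial ι ℂ} {n : ℕ}

theorem topologicalKrullDim_add_one_le (hZ : IsClosed Z) (hne : Z.Nonempty) :
    topologicalKrullDim Z + 1 ≤ ringKrullDim (MvPolynomial ι ℂ ⧸ coneIdeal Z) := by
  have : Nonempty {C : TopologicalSpace.IrreducibleCloseds (ProjSpace ι) // (C : Set _) ⊆ Z} := by
    obtain ⟨z, hz⟩ := hne
    exact ⟨⟨closure {z}, isIrreducible_singleton.closure, isClosed_closure⟩,
      closure_minimal (Set.singleton_subset_iff.mpr hz) hZ⟩
  rw [topologicalKrullDim_eq_krullDim_of_isClosed hZ, ← Order.krullDim_withBot,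
    ringKrullDim_quotient, ← Order.krullDim_orderDual (α := PrimeSpectrum.zeroLocus _)]
  let P (C : Set (ProjSpace ι)) (hC : IsPreirreducible C) (hCZ : C ⊆ Z) :
      (PrimeSpectrum.zeroLocus (coneIdeal Z : Set (MvPolynomial ι ℂ)))ᵒᵈ :=
    OrderDual.toDual ⟨⟨coneIdeal C, isPrime_coneIdeal hC⟩, coneIdeal_anti hCZ⟩
  -- the empty set, whose cone is the origin, extends each chain by one
  let T : WithBot {C : TopologicalSpace.IrreducibleCloseds (ProjSpace ι) // (C : Set _) ⊆ Z} →
      (PrimeSpectrum.zeroLocus (coneIdeal Z : Set (MvPolynomial ι ℂ)))ᵒᵈ :=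
    WithBot.recBotCoe (P ∅ isPreirreducible_empty (Set.empty_subset Z))
      fun C => P C C.1.isIrreducible.isPreirreducible C.2
  refine Order.krullDim_le_of_strictMono T (WithBot.strictMono_iff.mpr ⟨fun C D h => ?_,
    fun C => ?_⟩)
  · exact coneIdeal_lt_coneIdeal C.1.isClosed h
  · exact coneIdeal_lt_coneIdeal isClosed_empty
      (Set.empty_ssubset.mpr C.1.isIrreducible.nonempty)

/-- The homogenization of `f` with respect to the variable `X i`, which itself remains among the
variables of `f`. -/
def homogenizeAt (i : ι) (f : MvPolynomial ι ℂ) : MvPolynomial ι ℂ :=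
  ∑ e ∈ Finset.range (f.totalDegree + 1), X i ^ (f.totalDegree - e) * homogeneousComponent e f

theorem isHomogeneous_homogenizeAt (i : ι) (f : MvPolynomial ι ℂ) :
    (homogenizeAt i f).IsHomogeneous f.totalDegree := by
  refine IsHomogeneous.sum _ _ _ fun e he => ?_
  have := (isHomogeneous_X_pow (R := ℂ) i (f.totalDegree - e)).mul
    (homogeneousComponent_isHomogeneous e f)
  rwa [Nat.sub_add_cancel (by simpa [Nat.lt_succ_iff] using he)] at this

theorem homogenizeAt_sub_mem (hi : X i - 1 ∈ I) (f : MvPolynomial ι ℂ) :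
    homogenizeAt i f - f ∈ I := by
  nth_rw 2 [← sum_homogeneousComponent f]
  rw [homogenizeAt, ← Finset.sum_sub_distrib]
  refine Ideal.sum_mem _ fun e _ => ?_
  rw [← sub_one_mul]
  exact I.mul_mem_right _ (I.mem_of_dvd (sub_one_dvd_pow_sub_one _ _) hi)

theorem homogenizeAt_mem_iff (hi : X i - 1 ∈ I) : homogenizeAt i f ∈ I ↔ f ∈ I := by
  rw [← I.add_mem_iff_right (I.neg_mem (homogenizeAt_sub_mem hi f))]
  simp

/-- The projective closure of the zero locus of an ideal, which is meant to contain `X i - 1` for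
some `i` and then defines an affine variety in the chart `X i ≠ 0`. -/
def projClosure (I : Ideal (MvPolynomial ι ℂ)) : Set (ProjSpace ι) :=
  projZeros {f | f ∈ I ∧ ∃ n, f.IsHomogeneous n}

theorem isClosed_projClosure (I : Ideal (MvPolynomial ι ℂ)) : IsClosed (projClosure I) :=
  isClosed_iff_isZariskiClosed.mpr ⟨_, fun _ h => h.2, rfl⟩

theorem mem_of_mem_coneIdeal_projClosure [Finite ι] [I.IsPrime]
    (hf : f ∈ coneIdeal (projClosure I)) : f ∈ I := by
  rw [← IsPrime.vanishingIdeal_zeroLocus (K := ℂ) I, mem_vanishingIdeal_iff]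
  refine fun v hv => mem_coneIdeal_iff.mp hf v fun hv0 => ?_
  rintro g ⟨hg, m, hgm⟩
  obtain ⟨a, ha⟩ := Projectivization.exists_smul_eq_mk_rep ℂ v hv0
  have hvg : eval v g = 0 := hv g hg
  rw [← ha, Units.smul_def, eval_smul_of_isHomogeneous hgm, hvg, mul_zero]

theorem nonempty_projClosure [Finite ι] [hI : I.IsPrime] (hi : X i - 1 ∈ I) :
    (projClosure I).Nonempty := by
  by_contra! h
  have hX : X i ∈ I := mem_of_mem_coneIdeal_projClosure (by simp [h, cone_empty])
  exact hI.ne_top ((Ideal.eq_top_iff_one _).mpr (by simpa using I.sub_mem hX hi))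

theorem mem_coneIdeal_projClosure_iff [Finite ι] [I.IsPrime] (hi : X i - 1 ∈ I)
    (hf : f.IsHomogeneous n) : f ∈ coneIdeal (projClosure I) ↔ f ∈ I := by
  refine ⟨mem_of_mem_coneIdeal_projClosure, fun h => ?_⟩
  exact (mem_coneIdeal_iff_of_isHomogeneous (nonempty_projClosure hi) hf).mpr
    (subset_projZeros_singleton.mpr fun p hp => hp f ⟨h, n, hf⟩)

theorem isIrreducible_projClosure [Finite ι] [hI : I.IsPrime] (hi : X i - 1 ∈ I) :
    IsIrreducible (projClosure I) := by
  refine ⟨nonempty_projClosure hi, isPreirreducible_of_isPrime_coneIdeal <|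
    isPrime_coneIdeal_of_homogeneous fun hf hg => ?_⟩
  simpa only [mem_coneIdeal_projClosure_iff hi hf, mem_coneIdeal_projClosure_iff hi hg,
    mem_coneIdeal_projClosure_iff hi (hf.mul hg)] using hI.mem_or_mem

theorem projClosure_ssubset [Finite ι] [I.IsPrime] [J.IsPrime] (hi : X i - 1 ∈ I) (h : I < J) :
    projClosure J ⊂ projClosure I := by
  refine ⟨fun p hp f hf => hp f ⟨h.1 hf.1, hf.2⟩, fun hle => h.2 fun f hf => ?_⟩
  have hhom := isHomogeneous_homogenizeAt i f
  rw [← homogenizeAt_mem_iff (h.1 hi), ← mem_coneIdeal_projClosure_iff (h.1 hi) hhom] at hf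
  rw [← homogenizeAt_mem_iff hi, ← mem_coneIdeal_projClosure_iff hi hhom]
  exact coneIdeal_anti hle hf

theorem ringKrullDim_quotient_le_topologicalKrullDim [Finite ι] (hZ : IsClosed Z)
    (hi : X i - 1 ∈ I) (h : ∀ f ∈ coneIdeal Z, ∀ n, f.IsHomogeneous n → f ∈ I) :
    ringKrullDim (MvPolynomial ι ℂ ⧸ I) ≤ topologicalKrullDim Z := by
  rw [ringKrullDim_quotient, ← Order.krullDim_orderDual,
    topologicalKrullDim_eq_krullDim_of_isClosed hZ]
  refine Order.krullDim_le_of_strictMono (fun p =>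
    ⟨⟨projClosure p.ofDual.1.asIdeal, isIrreducible_projClosure (p.ofDual.2 hi),
      isClosed_projClosure _⟩, fun z hz => ?_⟩)
    fun p q hpq => projClosure_ssubset (q.ofDual.2 hi) hpq
  refine mem_of_forall_eval_rep_eq_zero hZ fun f hf => ?_
  rw [← sum_homogeneousComponent f, map_sum]
  refine Finset.sum_eq_zero fun n _ => hz _ ?_
  have hn := homogeneousComponent_isHomogeneous n f
  exact ⟨p.ofDual.2 (h _ (homogeneousComponent_mem_coneIdeal hf n) n hn), n, hn⟩

end Dimension

section Chart

theorem finrank_map_add_finrank_ker {K V W : Type*} [DivisionRing K] [AddCommGroup V] [Module K V]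
    [AddCommGroup W] [Module K W] [FiniteDimensional K V] {f : V →ₗ[K] W} {S : Submodule K V}
    (h : LinearMap.ker f ≤ S) :
    Module.finrank K (S.map f) + Module.finrank K (LinearMap.ker f) = Module.finrank K S := by
  rw [← LinearMap.range_domRestrict, ← (Submodule.comapSubtypeEquivOfLe h).finrank_eq,
    ← LinearMap.ker_domRestrict, LinearMap.finrank_range_add_finrank_ker]

variable {ι F : Type*} [Field F] {x : ι → F}

/-- The differential at `x` of the map `x ↦ x / x i` onto the chart where the `i`-th coordinate
is `1`. -/
def chartDifferential (x : ι → F) (i : ι) : (ι → F) →ₗ[F] (ι → F) :=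
  (x i)⁻¹ • LinearMap.id - (x i ^ 2)⁻¹ • (LinearMap.proj i).smulRight x

theorem ker_chartDifferential {i : ι} (hi : x i ≠ 0) :
    LinearMap.ker (chartDifferential x i) = Submodule.span F {x} := by
  ext w
  have hw : chartDifferential x i w = (x i)⁻¹ • (w - (w i / x i) • x) := by
    ext j
    simp [chartDifferential]
    field_simp
  rw [LinearMap.mem_ker, hw, smul_eq_zero_iff_right (inv_ne_zero hi), sub_eq_zero,
    Submodule.mem_span_singleton]
  refine ⟨fun h => ⟨_, h.symm⟩, ?_⟩
  rintro ⟨c, rfl⟩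
  simp [hi]

end Chart

section GenericPoint

variable {ι : Type} {F : Type*} [Field F] [Algebra ℂ F] {Z : Set (ProjSpace ι)} {x : ι → F}

/-- The point `x` with values in a field extension is a generic point of the cone over `Z`: it
satisfies exactly the polynomial relations which hold on the cone. -/
def IsGenericPoint (Z : Set (ProjSpace ι)) (x : ι → F) : Prop :=
  ∀ f, f ∈ coneIdeal Z ↔ aeval x f = 0

theorem IsGenericPoint.coneIdeal_eq_ker (hx : IsGenericPoint Z x) :
    coneIdeal Z = RingHom.ker (aeval x : MvPolynomial ι ℂ →ₐ[ℂ] F) :=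
  Ideal.ext hx

theorem sum_grad_homogeneousComponent (f : MvPolynomial ι ℂ) (x : ι → F) :
    ∑ n ∈ Finset.range (f.totalDegree + 1), grad (homogeneousComponent n f) x = grad f x := by
  conv_rhs => rw [← sum_homogeneousComponent f]
  funext i
  simp [grad]

theorem grad_dotProduct_self_of_isHomogeneous [Fintype ι] {f : MvPolynomial ι ℂ} {n : ℕ}
    (hf : f.IsHomogeneous n) (x : ι → F) : grad f x ⬝ᵥ x = n * aeval x f := by
  have h := congrArg (aeval x) hf.sum_X_mul_pderiv
  simpa [grad, dotProduct, mul_comm] using h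

theorem IsGenericPoint.self_mem_tangentSpace [Finite ι] (hx : IsGenericPoint Z x) :
    x ∈ tangentSpace ℂ x := by
  have := Fintype.ofFinite ι
  refine mem_tangentSpace_iff.mpr fun f hf => ?_
  rw [← sum_grad_homogeneousComponent, sum_dotProduct]
  refine Finset.sum_eq_zero fun n _ => ?_
  rw [grad_dotProduct_self_of_isHomogeneous (homogeneousComponent_isHomogeneous n f),
    (hx _).mp (homogeneousComponent_mem_coneIdeal ((hx f).mpr hf) n), mul_zero]

theorem map_chartDifferential_tangentSpace {i : ι} (hi : x i ≠ 0) :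
    (tangentSpace ℂ x).map (chartDifferential x i) = tangentSpace ℂ fun j => x j / x i := by
  rw [tangentSpace, tangentSpace, ← LinearMap.range_comp]
  congr 1
  ext D j
  simp only [chartDifferential, evalDer, LinearMap.comp_apply, LinearMap.sub_apply,
    LinearMap.smul_apply, LinearMap.id_apply, LinearMap.smulRight_apply, LinearMap.proj_apply,
    LinearMap.coe_mk, AddHom.coe_mk, Pi.sub_apply, Pi.smul_apply, smul_eq_mul,
    Derivation.leibniz_div]
  field_simp

theorem finrank_tangentSpace_div [Finite ι] (hx : x ∈ tangentSpace ℂ x) {i : ι} (hi : x i ≠ 0) :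
    Module.finrank F (tangentSpace ℂ fun j => x j / x i) + 1 =
      Module.finrank F (tangentSpace ℂ x) := by
  have hle : LinearMap.ker (chartDifferential x i) ≤ tangentSpace ℂ x := by
    rwa [ker_chartDifferential hi, Submodule.span_singleton_le_iff_mem]
  have h := finrank_map_add_finrank_ker hle
  rwa [map_chartDifferential_tangentSpace hi, ker_chartDifferential hi,
    finrank_span_singleton (fun h0 => hi (congrFun h0 i))] at h

theorem IsGenericPoint.eq_zero_iff (hx : IsGenericPoint Z x) : x = 0 ↔ Z = ∅ := by
  constructor
  · rintro rfl
    refine Set.eq_empty_iff_forall_notMem.mpr fun p hp => p.rep_nonzero (funext fun i => ?_)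
    simpa using eval_rep_of_mem_coneIdeal ((hx (X i)).mpr (by simp)) hp
  · rintro rfl
    exact funext fun i => by simpa using (hx (X i)).mp (by simp [cone_empty])

theorem IsGenericPoint.topologicalKrullDim_eq [Finite ι] (hZ : IsClosed Z)
    (hx : IsGenericPoint Z x) {i : ι} (hi : x i ≠ 0) :
    topologicalKrullDim Z = Module.finrank F (tangentSpace ℂ fun j => x j / x i) := by
  let y : ι → F := fun j => x j / x i
  have hne : Z.Nonempty := Set.nonempty_iff_ne_empty.mpr fun h =>
    hi (congrFun (hx.eq_zero_iff.mpr h) i)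
  have hupper := topologicalKrullDim_add_one_le hZ hne
  rw [hx.coneIdeal_eq_ker, ringKrullDim_quotient_ker_aeval,
    ← finrank_tangentSpace_div hx.self_mem_tangentSpace hi] at hupper
  have hy : y = (x i)⁻¹ • x := funext fun j => by simp [y, div_eq_inv_mul]
  have hlower := ringKrullDim_quotient_le_topologicalKrullDim
    (I := RingHom.ker (aeval y : MvPolynomial ι ℂ →ₐ[ℂ] F)) (i := i) hZ
    (by simp [RingHom.mem_ker, y, hi]) fun f hf n hn => by
      rw [RingHom.mem_ker, hy, aeval_smul_of_isHomogeneous hn, (hx f).mp hf, mul_zero]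
  rw [ringKrullDim_quotient_ker_aeval] at hlower
  exact le_antisymm (ENat.WithBot.add_le_add_one_right_iff.mp (by exact_mod_cast hupper)) hlower

theorem IsGenericPoint.dim_eq [Finite ι] (hZ : IsClosed Z) (hx : IsGenericPoint Z x) :
    dim Z = Module.finrank F (tangentSpace ℂ x) - 1 := by
  obtain rfl | hne := Z.eq_empty_or_nonempty
  · have hrange : evalDer ℂ x = 0 := by
      ext D i
      simp [hx.eq_zero_iff.mpr rfl, evalDer]
    rw [tangentSpace, hrange, LinearMap.range_zero]
    simp [dim]
  · obtain ⟨i, hi⟩ := Function.ne_iff.mp (mt hx.eq_zero_iff.mp hne.ne_empty)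
    rw [dim, if_neg hne.ne_empty, hx.topologicalKrullDim_eq hZ hi,
      ← finrank_tangentSpace_div hx.self_mem_tangentSpace hi]
    simp

end GenericPoint

/-! ### Ranks of symmetric block matrices -/

section MatrixRank

open Matrix

theorem det_submatrix_map {m n r R S : Type*} [Fintype r] [DecidableEq r] [CommRing R]
    [CommRing S]
    (M : Matrix m n R) (φ : R →+* S) (f : r → m) (g : r → n) :
    ((M.map φ).submatrix f g).det = φ (M.submatrix f g).det :=
  (φ.map_det _).symm

variable {m n K L R : Type*} [Fintype n] [Field K] [Field L] [CommRing R]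

theorem exists_linearIndependent_cols [Finite m] (M : Matrix m n K) :
    ∃ g : Fin M.rank → n, LinearIndependent K (M.submatrix id g).col := by
  have h : Module.finrank K (Submodule.span K (Set.range M.col)) = M.rank :=
    M.rank_eq_finrank_span_cols.symm
  obtain ⟨f, hf, -, hli⟩ := Submodule.exists_fun_fin_finrank_span_eq K (Set.range M.col)
  choose g hg using hf
  refine ⟨g ∘ Fin.cast h.symm, ?_⟩
  have hcol : (M.submatrix id (g ∘ Fin.cast h.symm)).col = f ∘ Fin.cast h.symm :=
    funext fun _ => hg _
  rw [hcol]
  exact hli.comp _ (Fin.cast_injective _)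

theorem exists_submatrix_det_ne_zero [Finite m] (M : Matrix m n K) :
    ∃ (f : Fin M.rank → m) (g : Fin M.rank → n), (M.submatrix f g).det ≠ 0 := by
  have := Fintype.ofFinite m
  obtain ⟨g, hg⟩ := exists_linearIndependent_cols M
  let N := (M.submatrix id g)ᵀ
  have hN : N.rank = M.rank := by
    have hrow : LinearIndependent K N.row := hg
    simpa using hrow.rank_matrix
  obtain ⟨f, hf⟩ := exists_linearIndependent_cols N
  refine ⟨f ∘ Fin.cast hN.symm, g, ?_⟩
  have hrows : LinearIndependent K (M.submatrix (f ∘ Fin.cast hN.symm) g).row :=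
    hf.comp _ (Fin.cast_injective hN.symm)
  rw [linearIndependent_rows_iff_isUnit, isUnit_iff_isUnit_det] at hrows
  exact hrows.ne_zero

theorem le_rank_of_submatrix_det_ne_zero (M : Matrix m n K) {r : ℕ} (f : Fin r → m)
    (g : Fin r → n) (h : (M.submatrix f g).det ≠ 0) : r ≤ M.rank := by
  have hle := rank_submatrix_le M f g
  rwa [rank_of_det_ne_zero h, Fintype.card_fin] at hle

theorem rank_map_le_of_ker_le [Finite m] (M : Matrix m n R) (φ : R →+* K) (ψ : R →+* L)
    (h : RingHom.ker φ ≤ RingHom.ker ψ) : (M.map ψ).rank ≤ (M.map φ).rank := by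
  obtain ⟨f, g, hfg⟩ := exists_submatrix_det_ne_zero (M.map ψ)
  refine le_rank_of_submatrix_det_ne_zero _ f g fun h0 => hfg ?_
  rw [det_submatrix_map] at h0 ⊢
  exact h h0

theorem exists_rank_map_le [Finite m] (M : Matrix m n R) (φ : R →+* K) :
    ∃ Δ : R, φ Δ ≠ 0 ∧ ∀ {L : Type*} [Field L] (ψ : R →+* L), ψ Δ ≠ 0 →
      (M.map φ).rank ≤ (M.map ψ).rank := by
  obtain ⟨f, g, hfg⟩ := exists_submatrix_det_ne_zero (M.map φ)
  rw [det_submatrix_map] at hfg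
  exact ⟨_, hfg, fun ψ hψ => le_rank_of_submatrix_det_ne_zero _ f g (by rwa [det_submatrix_map])⟩

theorem rank_add_le [Finite m] (A B : Matrix m n K) : (A + B).rank ≤ A.rank + B.rank := by
  have hle : LinearMap.range (A + B).mulVecLin ≤
      LinearMap.range A.mulVecLin ⊔ LinearMap.range B.mulVecLin := by
    rw [mulVecLin_add]
    exact LinearMap.range_add_le _ _
  exact (Submodule.finrank_mono hle).trans (Submodule.finrank_add_le_finrank_add_finrank _ _)

theorem card_le_rank_of_single_mem [Finite m] [DecidableEq m] (M : Matrix m n K) (W : Finset m)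
    (h : ∀ w ∈ W, Pi.single w 1 ∈ LinearMap.range M.mulVecLin) : W.card ≤ M.rank := by
  have hli : LinearIndependent K fun w : W => (Pi.single (w : m) (1 : K) : m → K) :=
    (Pi.linearIndependent_single_one m K).comp _ Subtype.val_injective
  let f : W → LinearMap.range M.mulVecLin := fun w => ⟨_, h w w.2⟩
  have hf : LinearIndependent K f := .of_comp (LinearMap.range M.mulVecLin).subtype hli
  exact (Fintype.card_coe W).symm.trans_le hf.fintype_card_le_finrank

section Blocks

variable [Fintype m]

theorem rank_fromBlocks_le (A : Matrix m m K) (B : Matrix n n K) (C : Matrix m n K)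
    (D : Matrix n m K) : (fromBlocks A C D B).rank ≤ A.rank + 2 * Fintype.card n := by
  classical
  have hsum : fromBlocks A C D B =
      fromRows (1 : Matrix m m K) (0 : Matrix n m K) * A *
          fromCols (1 : Matrix m m K) (0 : Matrix m n K) +
        fromRows C B * fromCols (0 : Matrix n m K) (1 : Matrix n n K) +
        fromRows (0 : Matrix m n K) (1 : Matrix n n K) * fromCols D (0 : Matrix n n K) := by
    rw [fromRows_mul, fromRows_mul_fromCols, fromRows_mul_fromCols, fromRows_mul_fromCols]
    simp [fromBlocks_add]
  have hcard {l o : Type _} [Fintype l] [Fintype o] (X : Matrix l n K) (Y : Matrix n o K) :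
      (X * Y).rank ≤ Fintype.card n := (rank_mul_le_left X Y).trans (rank_le_card_width X)
  rw [hsum, two_mul, ← add_assoc]
  refine (rank_add_le _ _).trans (add_le_add ((rank_add_le _ _).trans
    (add_le_add ?_ (hcard _ _))) (hcard _ _))
  exact (rank_mul_le_left _ _).trans (rank_mul_le_right _ A)

theorem rank_fromBlocks_swap (A : Matrix m m K) (B : Matrix n n K) (C : Matrix m n K)
    (D : Matrix n m K) : (fromBlocks A C D B).rank = (fromBlocks B D C A).rank := by
  rw [← rank_submatrix (fromBlocks A C D B) (Equiv.sumComm n m) (Equiv.sumComm n m)]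
  simp

end Blocks

section Diagonal

theorem exists_card_eq_min_le_card_union [DecidableEq n] {k : ℕ} (S : Finset n)
    (h : k ≤ Fintype.card n) :
    ∃ T : Finset n, T.card = k ∧ min (Fintype.card n) (S.card + k) ≤ (T ∪ S).card := by
  rcases le_total k Sᶜ.card with hk | hk
  · obtain ⟨T, hTS, hT⟩ := Finset.exists_subset_card_eq hk
    refine ⟨T, hT, ?_⟩
    rw [Finset.card_union_of_disjoint (Finset.disjoint_left.mpr fun a ha =>
      Finset.mem_compl.mp (hTS ha))]
    lia
  · obtain ⟨T, hST, -, hT⟩ := Finset.exists_subsuperset_card_eq (Finset.subset_univ Sᶜ) hk h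
    have huniv : T ∪ S = Finset.univ :=
      codisjoint_iff.mp ((isCompl_compl (x := S)).symm.codisjoint.mono_left hST)
    exact ⟨T, hT, by simp [huniv]⟩

variable [Fintype m]

theorem card_add_card_le_rank_fromBlocks_diagonal [DecidableEq n] [DecidableEq K]
    (σ : m ↪ n) (d : n → K) :
    Fintype.card m + (Finset.univ.map σ ∪ Finset.univ.filter fun b => d b ≠ 0).card ≤
      (fromBlocks 0 ((1 : Matrix n n K).submatrix σ id) ((1 : Matrix n n K).submatrix σ id)ᵀ
        (diagonal d)).rank := by
  classical
  set M := fromBlocks 0 ((1 : Matrix n n K).submatrix σ id) ((1 : Matrix n n K).submatrix σ id)ᵀ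
    (diagonal d) with hM
  have hcol (c : m ⊕ n) : M.col c ∈ LinearMap.range M.mulVecLin := ⟨_, M.mulVec_single_one c⟩
  have hσ (a : m) : Pi.single (Sum.inr (σ a)) 1 ∈ LinearMap.range M.mulVecLin := by
    convert hcol (Sum.inl a) using 1
    ext (i | i) <;> simp [hM, one_apply, Pi.single_apply]
  have hl (a : m) : Pi.single (Sum.inl a) 1 ∈ LinearMap.range M.mulVecLin := by
    convert Submodule.sub_mem _ (hcol (Sum.inr (σ a))) (Submodule.smul_mem _ (d (σ a)) (hσ a))
      using 1
    ext (i | i)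
    · simp [hM, one_apply, Pi.single_apply, eq_comm]
    · by_cases h : i = σ a <;> simp [hM, h]
  have hd {b : n} (hb : b ∉ Set.range σ) (hdb : d b ≠ 0) :
      Pi.single (Sum.inr b) 1 ∈ LinearMap.range M.mulVecLin := by
    convert Submodule.smul_mem _ (d b)⁻¹ (hcol (Sum.inr b)) using 1
    ext (i | i)
    · have hne : σ i ≠ b := fun h => hb ⟨i, h⟩
      simp [hM, hne]
    · by_cases h : i = b <;> simp [hM, h, hdb]
  rw [← Finset.card_univ, ← Finset.card_disjSum]
  refine card_le_rank_of_single_mem M _ fun w hw => ?_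
  obtain ⟨a, -, rfl⟩ | ⟨b, hb, rfl⟩ := Finset.mem_disjSum.mp hw
  · exact hl a
  · by_cases hbσ : b ∈ Set.range σ
    · obtain ⟨a, rfl⟩ := hbσ
      exact hσ a
    · exact hd hbσ (by simpa [show ¬∃ a, σ a = b from hbσ] using hb)

theorem exists_min_le_rank_fromBlocks_diagonal [DecidableEq n] (d : n → K)
    (h : Fintype.card m ≤ Fintype.card n) :
    ∃ C : Matrix m n K, min (Fintype.card m + Fintype.card n)
      ((diagonal d).rank + 2 * Fintype.card m) ≤ (fromBlocks 0 C Cᵀ (diagonal d)).rank := by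
  classical
  obtain ⟨T, hT, hle⟩ := exists_card_eq_min_le_card_union ({b | d b ≠ 0} : Finset n) h
  let σ : m ↪ n := (Fintype.equivOfCardEq (by simp [hT]) : m ≃ T).toEmbedding.trans
    (Function.Embedding.subtype _)
  have hσ : Finset.univ.map σ = T := by
    rw [← Finset.map_map, Finset.map_univ_equiv]
    exact T.attach_map_val
  have hrank := card_add_card_le_rank_fromBlocks_diagonal σ d
  refine ⟨_, le_trans ?_ hrank⟩
  rw [hσ, rank_diagonal, Fintype.card_subtype]
  lia

variable [CharZero K] {B : Matrix n n K}

theorem exists_congruent_diagonal [DecidableEq n] (hB : B.IsSymm) :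
    ∃ (P : Matrix n n K) (d : n → K), IsUnit P.det ∧ Pᵀ * B * P = diagonal d := by
  have : Invertible (2 : K) := invertibleOfNonzero two_ne_zero
  obtain ⟨v, hv⟩ := LinearMap.BilinForm.exists_orthogonal_basis
    (LinearMap.BilinForm.isSymm_iff.mp (isSymm_toBilin'_iff_isSymm.mpr hB))
  let e : Fin (Module.finrank K (n → K)) ≃ n := Fintype.equivOfCardEq (by simp)
  let P : Matrix n n K := (Pi.basisFun K n).toMatrix (v.reindex e)
  have hP : IsUnit P.det := by
    rw [← isUnit_iff_isUnit_det]
    have := (Pi.basisFun K n).invertibleToMatrix (v.reindex e)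
    exact isUnit_of_invertible P
  refine ⟨P, fun i => (Pᵀ * B * P) i i, hP, ?_⟩
  ext i j
  obtain rfl | hij := eq_or_ne i j
  · rw [diagonal_apply_eq]
  · rw [diagonal_apply_ne _ hij, Matrix.mul_assoc]
    have horth := hv (e.symm.injective.ne hij)
    change toBilin' B _ _ = 0 at horth
    rw [toBilin'_apply', ← v.reindex_apply, ← v.reindex_apply] at horth
    exact horth

theorem exists_min_le_rank_fromBlocks (hB : B.IsSymm) (h : Fintype.card m ≤ Fintype.card n) :
    ∃ C : Matrix m n K, min (Fintype.card m + Fintype.card n)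
      (B.rank + 2 * Fintype.card m) ≤ (fromBlocks 0 C Cᵀ B).rank := by
  classical
  obtain ⟨P, d, hP, hd⟩ := exists_congruent_diagonal hB
  obtain ⟨C, hC⟩ := exists_min_le_rank_fromBlocks_diagonal (m := m) d h
  refine ⟨C * P⁻¹, ?_⟩
  have hrank : (diagonal d).rank = B.rank := by
    rw [← hd, rank_mul_eq_left_of_isUnit_det _ _ hP,
      rank_mul_eq_right_of_isUnit_det _ _ (by rwa [det_transpose])]
  have hcongr : fromBlocks 0 C Cᵀ (diagonal d) = (fromBlocks 1 0 0 P)ᵀ *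
      fromBlocks 0 (C * P⁻¹) (C * P⁻¹)ᵀ B * fromBlocks 1 0 0 P := by
    rw [fromBlocks_transpose, fromBlocks_multiply, fromBlocks_multiply]
    simp [Matrix.mul_assoc, nonsing_inv_mul _ hP, ← hd, ← transpose_mul]
  rw [← hrank]
  refine hC.trans ?_
  rw [hcongr]
  exact (rank_mul_le_left _ _).trans (rank_mul_le_right _ _)

end Diagonal

end MatrixRank

/-! ### Conormal vectors and the dual variety -/

section Perp

variable {ι K : Type*} [Fintype ι] [Field K]

theorem nondegenerate_dotProductBilin :
    LinearMap.BilinForm.Nondegenerate (dotProductBilin K K : LinearMap.BilinForm K (ι → K)) := by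
  classical
  constructor <;> exact fun x hx => funext fun i => by simpa using hx (Pi.single i 1)

theorem isRefl_dotProductBilin :
    LinearMap.BilinForm.IsRefl (dotProductBilin K K : LinearMap.BilinForm K (ι → K)) :=
  fun x y h => by simpa [dotProduct_comm] using h

/-- The orthogonal complement of a subspace with respect to the dot product. For the tangent space
of a cone these are the equations of the tangent hyperplanes. -/
def perp (W : Submodule K (ι → K)) : Submodule K (ι → K) :=
  LinearMap.BilinForm.orthogonal (dotProductBilin K K) W

theorem mem_perp {W : Submodule K (ι → K)} {a : ι → K} : a ∈ perp W ↔ ∀ w ∈ W, a ⬝ᵥ w = 0 := by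
  simp [perp, LinearMap.BilinForm.mem_orthogonal_iff, dotProduct_comm]

theorem mem_perp_span {S : Set (ι → K)} {a : ι → K} :
    a ∈ perp (Submodule.span K S) ↔ ∀ w ∈ S, a ⬝ᵥ w = 0 := by
  rw [mem_perp]
  exact Submodule.span_le (p := LinearMap.ker (dotProductBilin K K a))

theorem perp_perp (W : Submodule K (ι → K)) : perp (perp W) = W :=
  LinearMap.BilinForm.orthogonal_orthogonal nondegenerate_dotProductBilin isRefl_dotProductBilin W

theorem finrank_perp (W : Submodule K (ι → K)) :
    Module.finrank K (perp W) + Module.finrank K W = Fintype.card ι := by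
  rw [perp, LinearMap.BilinForm.finrank_orthogonal nondegenerate_dotProductBilin,
    Nat.sub_add_cancel W.finrank_le, Module.finrank_fintype_fun_eq_card]

end Perp

section DualVariety

variable {ι : Type} {F : Type*} [Field F] [Algebra ℂ F] {Z : Set (ProjSpace ι)} {x : ι → F}
  {f g : MvPolynomial ι ℂ}

/-- The gradients at `x` of the polynomials vanishing on the cone over `Z`; they form a vector space
over `ℂ` only, even if `x` has coordinates in an extension field. -/
def grads (Z : Set (ProjSpace ι)) (x : ι → F) : Submodule ℂ (ι → F) :=
  ((coneIdeal Z).restrictScalars ℂ).map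
    (LinearMap.pi fun i => (aeval x).toLinearMap ∘ₗ (pderiv i).toLinearMap)

theorem mem_grads {a : ι → F} : a ∈ grads Z x ↔ ∃ f ∈ coneIdeal Z, grad f x = a :=
  Iff.rfl

theorem grad_mem_grads (hf : f ∈ coneIdeal Z) (x : ι → F) : grad f x ∈ grads Z x :=
  ⟨f, hf, rfl⟩

theorem perp_grads [Fintype ι] (Z : Set (ProjSpace ι)) (v : ι → ℂ) :
    perp (grads Z v) = coneTangentSpace Z v := by
  ext w
  change _ ↔ ∀ f ∈ coneIdeal Z, ∑ i, eval v (pderiv i f) * w i = 0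
  simp [mem_perp, mem_grads, grad, dotProduct, mul_comm (w _)]

theorem perp_coneTangentSpace [Fintype ι] (Z : Set (ProjSpace ι)) (v : ι → ℂ) :
    perp (coneTangentSpace Z v) = grads Z v := by
  rw [← perp_grads, perp_perp]

theorem IsGenericPoint.perp_span_grads [Fintype ι] (hx : IsGenericPoint Z x) :
    perp (Submodule.span F (grads Z x : Set (ι → F))) = tangentSpace ℂ x := by
  ext w
  simp [mem_tangentSpace_iff, mem_perp_span, mem_grads, dotProduct_comm w, hx.coneIdeal_eq_ker]

theorem IsGenericPoint.perp_tangentSpace [Fintype ι] (hx : IsGenericPoint Z x) :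
    perp (tangentSpace ℂ x) = Submodule.span F (grads Z x : Set (ι → F)) := by
  rw [← hx.perp_span_grads, perp_perp]

theorem coneTangentSpace_le_smul [Fintype ι] (Z : Set (ProjSpace ι)) (v : ι → ℂ) (c : ℂ) :
    coneTangentSpace Z v ≤ coneTangentSpace Z (c • v) := by
  intro w hw
  rw [← perp_grads, mem_perp] at hw ⊢
  rintro _ ⟨f, hf, rfl⟩
  change w ⬝ᵥ grad f (c • v) = 0
  rw [← sum_grad_homogeneousComponent, dotProduct_sum]
  refine Finset.sum_eq_zero fun n _ => ?_
  have hsmul : grad (homogeneousComponent n f) (c • v) =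
      c ^ (n - 1) • grad (homogeneousComponent n f) v :=
    funext fun i => aeval_smul_of_isHomogeneous (homogeneousComponent_isHomogeneous n f).pderiv c v
  rw [hsmul, dotProduct_smul, hw _ (grad_mem_grads (homogeneousComponent_mem_coneIdeal hf n) v),
    smul_zero]

theorem coneTangentSpace_smul [Fintype ι] (Z : Set (ProjSpace ι)) (v : ι → ℂ) {c : ℂ}
    (hc : c ≠ 0) : coneTangentSpace Z (c • v) = coneTangentSpace Z v := by
  refine le_antisymm ?_ (coneTangentSpace_le_smul Z v c)
  simpa [smul_smul, inv_mul_cancel₀ hc] using coneTangentSpace_le_smul Z (c • v) c⁻¹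

theorem coneTangentSpace_rep_mk [Fintype ι] (Z : Set (ProjSpace ι)) {v : ι → ℂ} (hv : v ≠ 0) :
    coneTangentSpace Z (Projectivization.mk ℂ v hv).rep = coneTangentSpace Z v := by
  obtain ⟨c, hc⟩ := Projectivization.exists_smul_eq_mk_rep ℂ v hv
  rw [← hc, Units.smul_def, coneTangentSpace_smul _ _ c.ne_zero]

theorem grads_le_cone_tangentHyperplanes [Fintype ι] {v : ι → ℂ} (hv : v ≠ 0)
    (h : IsSmoothPoint Z (Projectivization.mk ℂ v hv)) :
    (grads Z v : Set (ι → ℂ)) ⊆ cone (tangentHyperplanes Z) := by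
  intro a ha ha0
  refine ⟨_, h, fun w hw => ?_⟩
  rw [coneTangentSpace_rep_mk, ← perp_grads, mem_perp] at hw
  obtain ⟨d, hd⟩ := Projectivization.exists_smul_eq_mk_rep ℂ a ha0
  change _ ⬝ᵥ w = 0
  rw [← hd, Units.smul_def, smul_dotProduct, dotProduct_comm, hw a ha, smul_zero]

theorem exists_mem_grads_of_mem_cone_tangentHyperplanes [Fintype ι]
    (hne : (tangentHyperplanes Z).Nonempty) {a : ι → ℂ} (ha : a ∈ cone (tangentHyperplanes Z)) :
    ∃ p ∈ Z, a ∈ grads Z p.rep := by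
  obtain ⟨H, ⟨p, hp, hH⟩, c, rfl⟩ := exists_eq_smul_rep_of_mem_cone hne ha
  refine ⟨p, hp.1, Submodule.smul_mem _ _ ?_⟩
  rw [← perp_coneTangentSpace, mem_perp]
  exact hH

theorem aeval_aeval_pderiv (x : ι → F) (g f : MvPolynomial ι ℂ) :
    aeval x (aeval (fun i => pderiv i g) f) = aeval (grad g x) f := by
  rw [← AlgHom.comp_apply, comp_aeval]
  rfl

theorem mem_coneIdeal_dualVariety_of_forall [Fintype ι] (hx : IsGenericPoint Z x)
    (hf : ∀ ξ ∈ perp (tangentSpace ℂ x), aeval ξ f = 0) : f ∈ coneIdeal (dualVariety Z) := by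
  rw [dualVariety, coneIdeal_closure]
  obtain hempty | hne := (tangentHyperplanes Z).eq_empty_or_nonempty
  · have h0 := hf 0 (Submodule.zero_mem _)
    simpa [hempty, cone_empty] using h0
  refine mem_coneIdeal_iff.mpr fun a ha => ?_
  obtain ⟨p, hp, g, hg, rfl⟩ := exists_mem_grads_of_mem_cone_tangentHyperplanes hne ha
  change eval (grad g p.rep) f = 0
  rw [← coe_aeval_eq_eval, RingHom.coe_coe, ← aeval_aeval_pderiv]
  refine eval_rep_of_mem_coneIdeal ((hx _).mpr ?_) hp
  rw [aeval_aeval_pderiv, hf]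
  rw [hx.perp_tangentSpace]
  exact Submodule.subset_span (grad_mem_grads hg x)

/-- The Jacobian matrix of a family of polynomials. -/
def jacobian {m : ℕ} (g : Fin m → MvPolynomial ι ℂ) : Matrix (Fin m) ι (MvPolynomial ι ℂ) :=
  Matrix.of fun j i => pderiv i (g j)

theorem rank_jacobian_map [Fintype ι] {m : ℕ} (g : Fin m → MvPolynomial ι ℂ) (x : ι → F) :
    ((jacobian g).map (aeval x : MvPolynomial ι ℂ →ₐ[ℂ] F).toRingHom).rank =
      Module.finrank F (Submodule.span F (Set.range fun j => grad (g j) x)) :=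
  Matrix.rank_eq_finrank_span_row _

theorem rank_jacobian_map_le [Fintype ι] {m : ℕ} {g : Fin m → MvPolynomial ι ℂ}
    (hg : ∀ j, g j ∈ coneIdeal Z) (x : ι → F) :
    ((jacobian g).map (aeval x : MvPolynomial ι ℂ →ₐ[ℂ] F).toRingHom).rank ≤
      Module.finrank F (Submodule.span F (grads Z x : Set (ι → F))) := by
  rw [rank_jacobian_map]
  refine Submodule.finrank_mono (Submodule.span_mono ?_)
  rintro _ ⟨j, rfl⟩
  exact grad_mem_grads (hg j) x

theorem exists_rank_jacobian_map_eq [Fintype ι] (Z : Set (ProjSpace ι)) (x : ι → F) :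
    ∃ (m : ℕ) (g : Fin m → MvPolynomial ι ℂ), (∀ j, g j ∈ coneIdeal Z) ∧
      ((jacobian g).map (aeval x : MvPolynomial ι ℂ →ₐ[ℂ] F).toRingHom).rank =
        Module.finrank F (Submodule.span F (grads Z x : Set (ι → F))) := by
  obtain ⟨b, hb, hspan, -⟩ :=
    Submodule.exists_fun_fin_finrank_span_eq F (grads Z x : Set (ι → F))
  choose g hg hgb using hb
  obtain rfl : (fun j => grad (g j) x) = b := funext hgb
  exact ⟨_, g, hg, (rank_jacobian_map g x).trans
    (congrArg (fun V : Submodule F (ι → F) => Module.finrank F V) hspan)⟩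

theorem IsGenericPoint.finrank_span_grads_le [Finite ι] (hx : IsGenericPoint Z x) {v : ι → ℂ}
    (hv : v ∈ cone Z) :
    Module.finrank ℂ (grads Z v) ≤
      Module.finrank F (Submodule.span F (grads Z x : Set (ι → F))) := by
  have := Fintype.ofFinite ι
  obtain ⟨m, g, hg, hr⟩ := exists_rank_jacobian_map_eq Z v
  rw [Submodule.span_eq] at hr
  rw [← hr]
  refine (rank_map_le_of_ker_le (jacobian g) (aeval x : MvPolynomial ι ℂ →ₐ[ℂ] F).toRingHom
    _ fun f hf => ?_).trans (rank_jacobian_map_le hg x)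
  exact mem_coneIdeal_iff.mp ((hx f).mpr hf) v hv

theorem IsGenericPoint.exists_forall_isSmoothPoint [Fintype ι] (hx : IsGenericPoint Z x)
    (hZ : IsClosed Z) : ∃ Δ : MvPolynomial ι ℂ, aeval x Δ ≠ 0 ∧
      ∀ v ∈ cone Z, eval v Δ ≠ 0 → ∀ hv : v ≠ 0, IsSmoothPoint Z (Projectivization.mk ℂ v hv) := by
  obtain ⟨m, g, hg, hr⟩ := exists_rank_jacobian_map_eq Z x
  obtain ⟨Δ, hΔ, hle⟩ := exists_rank_map_le (jacobian g)
    (aeval x : MvPolynomial ι ℂ →ₐ[ℂ] F).toRingHom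
  refine ⟨Δ, hΔ, fun v hvZ hvΔ hv => ⟨hvZ hv, ?_⟩⟩
  have hlower := (hle (aeval v : MvPolynomial ι ℂ →ₐ[ℂ] ℂ).toRingHom hvΔ).trans
    (rank_jacobian_map_le hg v)
  rw [hr, Submodule.span_eq] at hlower
  have hupper := hx.finrank_span_grads_le hvZ
  have hcone := finrank_perp (grads Z v)
  have hgeneric := finrank_perp (Submodule.span F (grads Z x : Set (ι → F)))
  rw [perp_grads] at hcone
  rw [hx.perp_span_grads] at hgeneric
  rw [coneTangentSpace_rep_mk, hx.dim_eq hZ]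
  lia

theorem aeval_grad_eq_zero [Fintype ι] (hZ : IsClosed Z) (hne : Z.Nonempty)
    (hx : IsGenericPoint Z x) (hf : f ∈ coneIdeal (dualVariety Z)) (hg : g ∈ coneIdeal Z) :
    aeval (grad g x) f = 0 := by
  rw [dualVariety, coneIdeal_closure, mem_coneIdeal_iff] at hf
  obtain ⟨i, hi⟩ := Function.ne_iff.mp fun h => hne.ne_empty (hx.eq_zero_iff.mp h)
  obtain ⟨Δ, hΔ, hsmooth⟩ := hx.exists_forall_isSmoothPoint hZ
  have hmem : X i * Δ * aeval (fun i => pderiv i g) f ∈ coneIdeal Z := by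
    refine mem_coneIdeal_iff.mpr fun v hv => ?_
    rw [map_mul, map_mul, eval_X, mul_eq_zero, or_iff_not_imp_left, mul_eq_zero, not_or]
    rintro ⟨hvi, hvΔ⟩
    have hv0 : v ≠ 0 := fun h => hvi (by simp [h])
    rw [← coe_aeval_eq_eval, RingHom.coe_coe, aeval_aeval_pderiv]
    exact hf _ (grads_le_cone_tangentHyperplanes hv0 (hsmooth v hv hvΔ hv0) (grad_mem_grads hg v))
  have h0 := (hx _).mp hmem
  rw [map_mul, map_mul, aeval_aeval_pderiv, aeval_X] at h0
  exact (mul_eq_zero.mp h0).resolve_left (mul_ne_zero hi hΔ)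

theorem aeval_eq_zero_of_mem_span {k ι F : Type*} [Field k] [Infinite k] [Field F] [Algebra k F]
    {V : Submodule k (ι → F)} {f : MvPolynomial ι k} (h : ∀ a ∈ V, aeval a f = 0) {ξ : ι → F}
    (hξ : ξ ∈ Submodule.span F (V : Set (ι → F))) : aeval ξ f = 0 := by
  obtain ⟨m, s, e, rfl⟩ := Submodule.mem_span_set'.mp hξ
  let P : MvPolynomial (Fin m) F := aeval (fun i => ∑ j, C ((e j : ι → F) i) * X j) f
  have hP (t : Fin m → F) : eval t P = aeval (∑ j, t j • (e j : ι → F)) f := by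
    change ((aeval t : MvPolynomial _ F →ₐ[F] F).restrictScalars k) P = _
    rw [← AlgHom.comp_apply, comp_aeval]
    congr 2
    funext i
    simp [mul_comm]
  have hP0 : P = 0 := by
    refine funext_set (fun _ => Set.range (algebraMap k F))
      (fun _ => Set.infinite_range_of_injective (algebraMap k F).injective) fun t ht => ?_
    choose c hc using fun j => ht j (Set.mem_univ j)
    obtain rfl : (fun j => algebraMap k F (c j)) = t := funext hc
    rw [map_zero, hP]
    simp only [algebraMap_smul]
    exact h _ (V.sum_mem fun j _ => V.smul_mem _ (e j).2)
  rw [← hP, hP0, map_zero]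

theorem IsGenericPoint.mem_coneIdeal_dualVariety_iff [Fintype ι] (hx : IsGenericPoint Z x)
    (hZ : IsClosed Z) (hne : Z.Nonempty) :
    f ∈ coneIdeal (dualVariety Z) ↔ ∀ ξ ∈ perp (tangentSpace ℂ x), aeval ξ f = 0 := by
  refine ⟨fun hf ξ hξ => ?_, mem_coneIdeal_dualVariety_of_forall hx⟩
  rw [hx.perp_tangentSpace] at hξ
  refine aeval_eq_zero_of_mem_span ?_ hξ
  rintro _ ⟨g, hg, rfl⟩
  exact aeval_grad_eq_zero hZ hne hx hf hg

end DualVariety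

/-! ### The defect and the second fundamental form -/

section SecondForm

variable {k ι A F : Type*} [Field k] [Field F] [Algebra k F] [Fintype ι] {x ξ : ι → F}

theorem derivation_dotProduct (D : Derivation k F F) (u v : ι → F) :
    D (u ⬝ᵥ v) = u ⬝ᵥ evalDer k v D + v ⬝ᵥ evalDer k u D := by
  simp [dotProduct, evalDer, Finset.sum_add_distrib]

theorem dotProduct_evalDer_eq_zero (hξ : ξ ∈ perp (tangentSpace k x)) (D : Derivation k F F) :
    ξ ⬝ᵥ evalDer k x D = 0 :=
  mem_perp.mp hξ _ ⟨D, rfl⟩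

theorem dotProduct_evalDer_comm (hξ : ξ ∈ perp (tangentSpace k x)) (D E : Derivation k F F) :
    ξ ⬝ᵥ evalDer k (evalDer k x D) E = ξ ⬝ᵥ evalDer k (evalDer k x E) D := by
  rw [← sub_eq_zero, ← dotProduct_sub]
  exact dotProduct_evalDer_eq_zero hξ ⁅E, D⁆

theorem evalDer_dotProduct_evalDer (hξ : ξ ∈ perp (tangentSpace k x)) (D E : Derivation k F F) :
    evalDer k x D ⬝ᵥ evalDer k ξ E = -(ξ ⬝ᵥ evalDer k (evalDer k x E) D) := by
  have h := derivation_dotProduct E ξ (evalDer k x D)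
  rw [dotProduct_evalDer_eq_zero hξ, map_zero, dotProduct_evalDer_comm hξ] at h
  exact eq_neg_of_add_eq_zero_right h.symm

/-- The second fundamental form at `x` in the conormal direction `ξ`, as a matrix with respect to
the tangent vectors `D a x`. -/
def secondForm (D : A → Derivation k F F) (x : ι → F) : (ι → F) →ₗ[F] Matrix A A F where
  toFun ξ := Matrix.of fun a b => ξ ⬝ᵥ evalDer k (evalDer k x (D b)) (D a)
  map_add' _ _ := by ext; simp
  map_smul' _ _ := by ext; simp

theorem secondForm_apply (D : A → Derivation k F F) (x ξ : ι → F) (a b : A) :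
    secondForm D x ξ a b = ξ ⬝ᵥ evalDer k (evalDer k x (D b)) (D a) :=
  rfl

theorem isSymm_secondForm (hξ : ξ ∈ perp (tangentSpace k x)) (D : A → Derivation k F F) :
    (secondForm D x ξ).IsSymm :=
  Matrix.IsSymm.ext fun _ _ => dotProduct_evalDer_comm hξ _ _

theorem secondForm_elim_of_evalDer_eq_self (D₀ : Derivation k F F) (hD₀ : evalDer k x D₀ = x)
    (D : A → Derivation k F F) {ξ : ι → F} (hξ : ξ ∈ perp (tangentSpace k x)) :
    secondForm (Sum.elim (fun _ : Unit => D₀) D) x ξ =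
      Matrix.fromBlocks 0 0 0 (secondForm D x ξ) := by
  have hzero (E : Derivation k F F) : ξ ⬝ᵥ evalDer k (evalDer k x D₀) E = 0 := by
    rw [hD₀, dotProduct_evalDer_eq_zero hξ]
  ext (a | a) (_ | b)
  · exact hzero D₀
  · exact (dotProduct_evalDer_comm hξ _ _).trans (hzero (D b))
  · exact hzero (D a)
  · rfl

theorem ker_mulVecLin_of (v : A → ι → F) :
    LinearMap.ker (Matrix.of v).mulVecLin = perp (Submodule.span F (Set.range v)) := by
  ext w
  rw [mem_perp_span, Set.forall_mem_range, LinearMap.mem_ker, funext_iff]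
  exact forall_congr' fun a => by rw [dotProduct_comm]; rfl

theorem map_eq_range_of_ker_le {K M V W : Type*} [Ring K] [AddCommGroup M] [Module K M]
    [AddCommGroup V] [Module K V] [AddCommGroup W] [Module K W] {f : M →ₗ[K] V} {g : M →ₗ[K] W}
    (h : LinearMap.ker f ≤ LinearMap.ker g) {S : Submodule K M}
    (hS : S.map f = LinearMap.range f) : S.map g = LinearMap.range g := by
  have htop : S ⊔ LinearMap.ker f = ⊤ := by
    rw [← Submodule.comap_map_eq, hS, LinearMap.range_eq_map, Submodule.comap_map_eq, top_sup_eq]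
  rw [LinearMap.range_eq_map, ← htop, Submodule.map_sup]
  exact (sup_eq_left.mpr (((Submodule.map_le_iff_le_comap (q := ⊥)).mpr h).trans bot_le)).symm

/- The vector `(D a x ⬝ᵥ E ξ)_a` depends only on `E x`, by the symmetry of the second fundamental
form, so `E` may be taken to be a combination of the derivations `D a`. -/
theorem map_tangentSpace_conormal [Fintype A] (hξ : ξ ∈ perp (tangentSpace k x))
    {D : A → Derivation k F F}
    (hD : Submodule.span F (Set.range fun a => evalDer k x (D a)) = tangentSpace k x) :
    (tangentSpace k ξ).map (Matrix.of fun a => evalDer k x (D a)).mulVecLin =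
      LinearMap.range (secondForm D x ξ).mulVecLin := by
  let φ := (Matrix.of fun a => evalDer k x (D a)).mulVecLin ∘ₗ evalDer k ξ
  have happly (E : Derivation k F F) :
      φ E = fun a => -(ξ ⬝ᵥ evalDer k (evalDer k x E) (D a)) :=
    funext fun a => evalDer_dotProduct_evalDer hξ (D a) E
  have hker : LinearMap.ker (evalDer k x) ≤ LinearMap.ker φ := by
    intro E hE
    rw [LinearMap.mem_ker] at hE ⊢
    rw [happly, hE]
    simp [evalDer, dotProduct, funext_iff]
  have hcol : φ ∘ D = -(secondForm D x ξ).col := funext fun b => happly (D b)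
  rw [tangentSpace, ← LinearMap.range_comp, ← map_eq_range_of_ker_le hker
    (S := Submodule.span F (Set.range D)), Submodule.map_span, ← Set.range_comp, hcol,
    Matrix.range_mulVecLin, ← Submodule.span_neg]
  · congr 1
    ext
    simp
  · rw [Submodule.map_span, ← Set.range_comp]
    exact hD

theorem finrank_tangentSpace_of_perp_le [Fintype A] (hξ : ξ ∈ perp (tangentSpace k x))
    (hle : perp (tangentSpace k x) ≤ tangentSpace k ξ) {D : A → Derivation k F F}
    (hD : Submodule.span F (Set.range fun a => evalDer k x (D a)) = tangentSpace k x) :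
    Module.finrank F (tangentSpace k ξ) =
      Module.finrank F (perp (tangentSpace k x)) + (secondForm D x ξ).rank := by
  have hker := ker_mulVecLin_of fun a => evalDer k x (D a)
  rw [hD] at hker
  rw [← finrank_map_add_finrank_ker (hker.trans_le hle), map_tangentSpace_conormal hξ hD, hker,
    add_comm, Matrix.rank]

end SecondForm

section ExtendScalars

variable {ι K : Type*} [Field K] (L : Type*) [Field L] [Algebra K L]

/-- The subspace over a field extension spanned by a subspace. -/
def extendScalars (W : Submodule K (ι → K)) : Submodule L (ι → L) :=
  Submodule.span L (W.map (Pi.algebraMap ι K L))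

theorem extendScalars_span (S : Set (ι → K)) :
    extendScalars L (Submodule.span K S) = Submodule.span L (Pi.algebraMap ι K L '' S) := by
  rw [extendScalars, Submodule.map_span, Submodule.span_span_of_tower]

theorem extendScalars_le {W : Submodule K (ι → K)} {V : Submodule L (ι → L)} :
    extendScalars L W ≤ V ↔ ∀ w ∈ W, algebraMap K L ∘ w ∈ V := by
  rw [extendScalars, Submodule.span_le, Submodule.map_coe, Set.image_subset_iff]
  rfl

theorem exists_linearIndependent_span_eq {V : Type*} [AddCommGroup V] [Module K V]
    [FiniteDimensional K V] (W : Submodule K V) :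
    ∃ (m : ℕ) (b : Fin m → V), LinearIndependent K b ∧ Submodule.span K (Set.range b) = W := by
  obtain ⟨b, -, hspan, hb⟩ := Submodule.exists_fun_fin_finrank_span_eq K (W : Set V)
  exact ⟨_, b, hb, hspan.trans W.span_eq⟩

theorem finrank_extendScalars [Finite ι] (W : Submodule K (ι → K)) :
    Module.finrank L (extendScalars L W) = Module.finrank K W := by
  obtain ⟨m, b, hb, rfl⟩ := exists_linearIndependent_span_eq W
  have hb' : LinearIndependent L (Pi.algebraMap ι K L ∘ b) :=
    linearIndependent_algebraMap_comp_iff.mpr hb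
  rw [extendScalars_span, ← Set.range_comp, finrank_span_eq_card hb', finrank_span_eq_card hb]

theorem perp_extendScalars [Fintype ι] (W : Submodule K (ι → K)) :
    perp (extendScalars L W) = extendScalars L (perp W) := by
  symm
  refine Submodule.eq_of_le_of_finrank_eq ((extendScalars_le L).mpr fun a ha => ?_) ?_
  · rw [extendScalars, mem_perp_span]
    rintro _ ⟨w, hw, rfl⟩
    refine (RingHom.map_dotProduct _ _ _).symm.trans ?_
    rw [mem_perp.mp ha w hw, map_zero]
  · have h := finrank_perp W
    have h' := finrank_perp (extendScalars L W)
    rw [finrank_extendScalars] at h' ⊢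
    lia

variable {F : Type*} [Field F] [Algebra ℂ F] {ι : Type} {Z : Set (ProjSpace ι)} {x : ι → F}
  [Algebra ℂ L] [Algebra F L] [IsScalarTower ℂ F L]

theorem IsGenericPoint.map (hx : IsGenericPoint Z x) : IsGenericPoint Z (algebraMap F L ∘ x) := by
  intro f
  rw [hx f, aeval_algebraMap_apply, map_eq_zero_iff _ (algebraMap F L).injective]

theorem span_grads_map (Z : Set (ProjSpace ι)) (x : ι → F) :
    Submodule.span L (grads Z (algebraMap F L ∘ x) : Set (ι → L)) =
      extendScalars L (Submodule.span F (grads Z x)) := by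
  have hgrad (f : MvPolynomial ι ℂ) :
      grad f (algebraMap F L ∘ x) = Pi.algebraMap ι F L (grad f x) := by
    funext i
    rw [grad, aeval_algebraMap_apply]
    rfl
  rw [extendScalars_span]
  congr 1
  ext a
  simp [mem_grads, hgrad]

theorem IsGenericPoint.tangentSpace_map [Finite ι] (hx : IsGenericPoint Z x) :
    tangentSpace ℂ (algebraMap F L ∘ x) = extendScalars L (tangentSpace ℂ x) := by
  have := Fintype.ofFinite ι
  rw [← (hx.map L).perp_span_grads, span_grads_map, perp_extendScalars, hx.perp_span_grads]

end ExtendScalars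

section GenericConormal

/-- The field of rational functions over `F` in the variables `σ`. -/
abbrev RatField (F σ : Type*) [Field F] : Type _ :=
  FractionRing (MvPolynomial σ F)

/-- The linear combination of the vectors `e j` whose coefficients are the variables of
`RatField F σ`; it is a generic vector of the span of the `e j`. -/
def genericComb {F σ ι : Type*} [Field F] [Fintype σ] (e : σ → ι → F) : ι → RatField F σ :=
  ∑ j, algebraMap (MvPolynomial σ F) (RatField F σ) (X j) • (algebraMap F (RatField F σ) ∘ e j)

variable {k σ A F : Type*} [Field k] [Field F] [Algebra k F] [Fintype σ]

theorem genericComb_apply {ι : Type*} (e : σ → ι → F) (i : ι) :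
    genericComb e i = ∑ j, algebraMap (MvPolynomial σ F) (RatField F σ) (X j) *
      algebraMap F (RatField F σ) (e j i) := by
  rw [genericComb, Finset.sum_apply]
  rfl

theorem aeval_genericComb_eq_zero_iff [Infinite F] {ι : Type*} (e : σ → ι → F)
    (f : MvPolynomial ι k) :
    aeval (genericComb e) f = 0 ↔ ∀ s : σ → F, aeval (∑ j, s j • e j) f = 0 := by
  let y (i : ι) : MvPolynomial σ F := ∑ j, X j * C (e j i)
  have hy : genericComb e = algebraMap (MvPolynomial σ F) (RatField F σ) ∘ y := by
    funext i
    rw [genericComb_apply, Function.comp_apply, map_sum]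
    simp_rw [map_mul]
    rfl
  have heval (s : σ → F) : eval s (aeval y f) = aeval (∑ j, s j • e j) f := by
    let φ : MvPolynomial σ F →ₐ[F] F := aeval s
    have : φ ∘ y = ∑ j, s j • e j := by
      funext i
      simp [φ, y, Finset.sum_apply]
    rw [← this, ← aeval_eq_eval]
    exact comp_aeval_apply y (φ.restrictScalars k) f
  rw [hy, aeval_algebraMap_apply, map_eq_zero_iff _ (IsFractionRing.injective _ _)]
  simp only [← heval]
  exact ⟨fun h s => by rw [h, map_zero], fun h => MvPolynomial.funext fun s => by simp [h s]⟩

theorem exists_isGreatest_rank_pencil [Infinite F] [Fintype A] (Q : σ → Matrix A A F) :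
    IsGreatest (Set.range fun s : σ → F => (∑ j, s j • Q j).rank)
      (∑ j, algebraMap (MvPolynomial σ F) (RatField F σ) (X j) •
        (Q j).map (algebraMap F (RatField F σ))).rank := by
  let P : Matrix A A (MvPolynomial σ F) := Matrix.of fun a b => ∑ j, X j * C (Q j a b)
  let φ := algebraMap (MvPolynomial σ F) (RatField F σ)
  have hmap {K : Type _} [Field K] (ψ : MvPolynomial σ F →+* K) :
      P.map ψ = ∑ j, ψ (X j) • (Q j).map (ψ.comp C) := by
    ext a b
    simp [P, Matrix.sum_apply]
  have heval (s : σ → F) : P.map (eval s) = ∑ j, s j • Q j := by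
    ext a b
    simp [P, Matrix.sum_apply]
  have hgen : P.map φ = ∑ j, φ (X j) • (Q j).map (algebraMap F (RatField F σ)) := hmap φ
  have hle {K : Type _} [Field K] (ψ : MvPolynomial σ F →+* K) :
      (P.map ψ).rank ≤ (P.map φ).rank := by
    refine rank_map_le_of_ker_le P φ ψ ?_
    rw [(RingHom.injective_iff_ker_eq_bot φ).mp (IsFractionRing.injective _ _)]
    exact bot_le
  rw [← hgen]
  simp only [← heval]
  constructor
  · obtain ⟨Δ, hΔ, hge⟩ := exists_rank_map_le P φ
    obtain ⟨s, hs⟩ : ∃ s, eval s Δ ≠ 0 := by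
      by_contra! h
      exact hΔ (by rw [MvPolynomial.funext (p := Δ) (q := 0) (by simpa using h), map_zero])
    exact ⟨s, le_antisymm (hle _) (hge _ hs)⟩
  · rintro _ ⟨s, rfl⟩
    exact hle _

theorem span_le_tangentSpace_genericComb [CharZero F] {ι : Type*} (e : σ → ι → F) :
    extendScalars (RatField F σ) (Submodule.span F (Set.range e)) ≤
      tangentSpace k (genericComb e) := by
  rw [extendScalars_span, ← Set.range_comp, Submodule.span_le]
  rintro _ ⟨j, rfl⟩
  classical
  obtain ⟨D, hD⟩ := exists_derivation_extending
    (IsFractionRing.injective (MvPolynomial σ F) (RatField F σ))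
    ((mkDerivation F (Pi.single j (1 : RatField F σ))).restrictScalars k)
  have hX (l : σ) : D (algebraMap _ _ (X l)) = Pi.single (M := fun _ => RatField F σ) j 1 l :=
    (hD _).trans (mkDerivation_X F _ l)
  have hC (c : F) : D (algebraMap F _ c) = 0 :=
    (hD _).trans (derivation_C (mkDerivation F _) c)
  refine ⟨D, ?_⟩
  funext i
  change _ = algebraMap F _ (e j i)
  simp [evalDer, genericComb_apply, hX, hC, Pi.single_apply]

variable {ι : Type*} [Fintype ι] {L : Type*} [Field L] [Algebra k L] [Algebra F L]

theorem exists_derivation_map [CharZero F] [IsScalarTower k F L] (D : Derivation k F F) :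
    ∃ E : Derivation k L L, ∀ a, E (algebraMap F L a) = algebraMap F L (D a) :=
  exists_derivation_extending (algebraMap F L).injective ((Algebra.linearMap F L).compDer D)

theorem secondForm_map {D : A → Derivation k F F} {D' : A → Derivation k L L}
    (hD' : ∀ a y, D' a (algebraMap F L y) = algebraMap F L (D a y)) (x ξ : ι → F) :
    secondForm D' (algebraMap F L ∘ x) (algebraMap F L ∘ ξ) =
      (secondForm D x ξ).map (algebraMap F L) := by
  ext a b
  simp [secondForm_apply, evalDer, dotProduct, hD']

/-- The ranks of the second fundamental forms at `x` in all conormal directions. -/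
def secondRanks [Fintype A] (D : A → Derivation k F F) (x : ι → F) : Set ℕ :=
  (fun ξ => (secondForm D x ξ).rank) '' perp (tangentSpace k x)

theorem exists_isGreatest_secondRanks [Fintype A] (D : A → Derivation k F F) (x : ι → F) :
    ∃ r, IsGreatest (secondRanks D x) r := by
  refine BddAbove.exists_isGreatest_of_nonempty ⟨Fintype.card A, ?_⟩ ⟨_, 0, zero_mem _, rfl⟩
  rintro _ ⟨ξ, -, rfl⟩
  exact Matrix.rank_le_card_width _

theorem secondRanks_eq_range [Fintype A] (D : A → Derivation k F F) {x : ι → F} {e : σ → ι → F}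
    (he : Submodule.span F (Set.range e) = perp (tangentSpace k x)) :
    secondRanks D x = Set.range fun s : σ → F => (∑ j, s j • secondForm D x (e j)).rank := by
  ext r
  simp [secondRanks, ← he, Submodule.mem_span_range_iff_exists_fun]

end GenericConormal

theorem rank_fromBlocks_zero {m n K : Type*} [Fintype m] [Fintype n] [Field K]
    (B : Matrix n n K) :
    (Matrix.fromBlocks (0 : Matrix m m K) 0 0 B).rank = B.rank := by
  classical
  refine le_antisymm ?_ (Matrix.rank_submatrix_le (Matrix.fromBlocks 0 0 0 B) Sum.inr Sum.inr)
  have : Matrix.fromBlocks (0 : Matrix m m K) 0 0 B =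
      Matrix.fromRows (0 : Matrix m n K) 1 * B * Matrix.fromCols (0 : Matrix n m K) 1 := by
    rw [Matrix.fromRows_mul, Matrix.fromRows_mul_fromCols]
    simp
  rw [this]
  exact (Matrix.rank_mul_le_left _ _).trans (Matrix.rank_mul_le_right _ _)

section DualVariety

variable {ι : Type} [Fintype ι] {A σ F : Type*} [Fintype A] [Fintype σ] [Field F] [Algebra ℂ F]
  {Z : Set (ProjSpace ι)} {x : ι → F} {e : σ → ι → F}

theorem IsGenericPoint.isGenericPoint_genericComb (hx : IsGenericPoint Z x) (hZ : IsClosed Z)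
    (hne : Z.Nonempty) (he : Submodule.span F (Set.range e) = perp (tangentSpace ℂ x)) :
    IsGenericPoint (dualVariety Z) (genericComb e) := by
  have : Infinite F := Infinite.of_injective _ (algebraMap ℂ F).injective
  intro f
  rw [hx.mem_coneIdeal_dualVariety_iff hZ hne, aeval_genericComb_eq_zero_iff, ← he]
  simp [Submodule.mem_span_range_iff_exists_fun]

theorem IsGenericPoint.finrank_tangentSpace_dualVariety (hx : IsGenericPoint Z x)
    (he : Submodule.span F (Set.range e) = perp (tangentSpace ℂ x))
    {D : A → Derivation ℂ F F}
    (hD : Submodule.span F (Set.range fun a => evalDer ℂ x (D a)) = tangentSpace ℂ x) {r : ℕ}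
    (hr : IsGreatest (secondRanks D x) r) :
    Module.finrank (RatField F σ) (tangentSpace ℂ (genericComb e)) =
      Module.finrank F (perp (tangentSpace ℂ x)) + r := by
  have : CharZero F := charZero_of_injective_algebraMap (algebraMap ℂ F).injective
  choose D' hD' using fun a => exists_derivation_map (L := RatField F σ) (D a)
  have htangent := hx.tangentSpace_map (RatField F σ)
  have hperp : perp (tangentSpace ℂ (algebraMap F (RatField F σ) ∘ x)) =
      extendScalars (RatField F σ) (perp (tangentSpace ℂ x)) := by
    rw [htangent, perp_extendScalars]
  have hmem : genericComb e ∈ perp (tangentSpace ℂ (algebraMap F (RatField F σ) ∘ x)) := by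
    rw [hperp]
    refine Submodule.sum_mem _ fun j _ => Submodule.smul_mem _ _ ?_
    refine Submodule.subset_span ⟨e j, ?_, rfl⟩
    rw [← he]
    exact Submodule.subset_span ⟨j, rfl⟩
  have hle : perp (tangentSpace ℂ (algebraMap F (RatField F σ) ∘ x)) ≤
      tangentSpace ℂ (genericComb e) := by
    rw [hperp, ← he]
    exact span_le_tangentSpace_genericComb e
  have hspan : Submodule.span (RatField F σ)
      (Set.range fun a => evalDer ℂ (algebraMap F (RatField F σ) ∘ x) (D' a)) =
        tangentSpace ℂ (algebraMap F (RatField F σ) ∘ x) := by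
    rw [htangent, ← hD, extendScalars_span, ← Set.range_comp]
    congr 2
    funext a i
    exact hD' a (x i)
  have hform : (secondForm D' (algebraMap F (RatField F σ) ∘ x) (genericComb e)).rank = r := by
    rw [genericComb, map_sum]
    simp_rw [map_smul, secondForm_map hD']
    rw [secondRanks_eq_range D he] at hr
    exact (exists_isGreatest_rank_pencil _).unique hr
  rw [finrank_tangentSpace_of_perp_le hmem hle hspan, hform, hperp, finrank_extendScalars]

/- The Euler derivation, which fixes `x`, contributes nothing to the second fundamental form, so
the frame `D` only has to span the tangent space together with `x`. -/
theorem IsGenericPoint.defect_eq (hx : IsGenericPoint Z x) (hZ : IsClosed Z) (hne : Z.Nonempty)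
    {D : A → Derivation ℂ F F}
    (hD : Submodule.span F (insert x (Set.range fun a => evalDer ℂ x (D a))) = tangentSpace ℂ x)
    {r : ℕ} (hr : IsGreatest (secondRanks D x) r) :
    defect Z = dim Z - r := by
  obtain ⟨D₀, hD₀⟩ := hx.self_mem_tangentSpace
  let D' : Unit ⊕ A → Derivation ℂ F F := Sum.elim (fun _ => D₀) D
  have hD' : Submodule.span F (Set.range fun a => evalDer ℂ x (D' a)) = tangentSpace ℂ x := by
    rw [← hD]
    congr 1
    ext v
    simp [D', hD₀, eq_comm]
  have hranks : secondRanks D' x = secondRanks D x :=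
    Set.image_congr fun ξ hξ => by
      simp only [D', secondForm_elim_of_evalDer_eq_self D₀ hD₀ D hξ, rank_fromBlocks_zero]
  obtain ⟨m, e, -, he⟩ := exists_linearIndependent_span_eq (perp (tangentSpace ℂ x))
  have hdual : dim (dualVariety Z) = _ :=
    (hx.isGenericPoint_genericComb hZ hne he).dim_eq isClosed_closure
  rw [hx.finrank_tangentSpace_dualVariety he hD' (hranks ▸ hr)] at hdual
  have hdim := hx.dim_eq hZ
  have hperp := finrank_perp (tangentSpace ℂ x)
  rw [defect, codim]
  lia

end DualVariety

/-! ### Generic points of products -/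

section GenericPair

variable {ι κ : Type} {F : Type*} [Field F] [Algebra ℂ F] {X₁ : Set (ProjSpace ι)}
  {X₂ : Set (ProjSpace κ)} {x : ι → F} {y : κ → F} {f : MvPolynomial (ι ⊕ κ) ℂ}

/-- The ideal of the polynomials vanishing on the product of the cones over `X₁` and `X₂`. -/
def conePairIdeal (X₁ : Set (ProjSpace ι)) (X₂ : Set (ProjSpace κ)) :
    Ideal (MvPolynomial (ι ⊕ κ) ℂ) :=
  vanishingIdeal ℂ (Set.image2 Sum.elim (cone X₁) (cone X₂))

theorem mem_conePairIdeal_iff :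
    f ∈ conePairIdeal X₁ X₂ ↔ ∀ v ∈ cone X₁, ∀ w ∈ cone X₂, eval (Sum.elim v w) f = 0 :=
  mem_vanishingIdeal_iff.trans Set.forall_mem_image2

/-- The substitution of constants for the variables of the second group. -/
def evalRight (w : κ → ℂ) : MvPolynomial (ι ⊕ κ) ℂ →ₐ[ℂ] MvPolynomial ι ℂ :=
  aeval (Sum.elim X fun j => C (w j))

/-- The substitution of constants for the variables of the first group. -/
def evalLeft (v : ι → ℂ) : MvPolynomial (ι ⊕ κ) ℂ →ₐ[ℂ] MvPolynomial κ ℂ :=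
  aeval (Sum.elim (fun i => C (v i)) X)

theorem aeval_evalRight (x : ι → F) (w : κ → ℂ) (f : MvPolynomial (ι ⊕ κ) ℂ) :
    aeval x (evalRight w f) = aeval (Sum.elim x (algebraMap ℂ F ∘ w)) f := by
  rw [evalRight, ← AlgHom.comp_apply, comp_aeval]
  congr 2
  ext (i | j) <;> simp

theorem eval_evalRight (v : ι → ℂ) (w : κ → ℂ) (f : MvPolynomial (ι ⊕ κ) ℂ) :
    eval v (evalRight w f) = eval (Sum.elim v w) f :=
  aeval_evalRight v w f

theorem eval_evalLeft (v : ι → ℂ) (w : κ → ℂ) (f : MvPolynomial (ι ⊕ κ) ℂ) :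
    eval w (evalLeft v f) = eval (Sum.elim v w) f := by
  change aeval w (evalLeft v f) = aeval (Sum.elim v w) f
  rw [evalLeft, ← AlgHom.comp_apply, comp_aeval]
  congr 2
  ext (i | j) <;> simp

theorem evalRight_mem_coneIdeal (hf : f ∈ conePairIdeal X₁ X₂) {w : κ → ℂ} (hw : w ∈ cone X₂) :
    evalRight w f ∈ coneIdeal X₁ :=
  mem_coneIdeal_iff.mpr fun v hv => by
    rw [eval_evalRight, mem_conePairIdeal_iff.mp hf v hv w hw]

/- Both `f` and `g` are nonzero at some common `s` in the cone over `X₁` (with different second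
coordinates), because the ideal of `X₁` is prime; then so is `f * g` at some `(s, t)`, because the
ideal of `X₂` is prime. -/
theorem isPrime_conePairIdeal (h₁ : IsPreirreducible X₁) (h₂ : IsPreirreducible X₂) :
    (conePairIdeal X₁ X₂).IsPrime := by
  refine ⟨fun h => ?_, fun {f g} hfg => ?_⟩
  · rw [Ideal.eq_top_iff_one, mem_conePairIdeal_iff] at h
    simpa using h 0 (fun h0 => absurd rfl h0) 0 (fun h0 => absurd rfl h0)
  · by_contra! h
    simp only [mem_conePairIdeal_iff, not_forall] at h
    obtain ⟨⟨v, hv, w, hw, hf⟩, ⟨v', hv', w', hw', hg⟩⟩ := h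
    have hright : evalRight w f * evalRight w' g ∉ coneIdeal X₁ :=
      (isPrime_coneIdeal h₁).mul_notMem
        (fun h => hf (by rw [← eval_evalRight, mem_coneIdeal_iff.mp h v hv]))
        (fun h => hg (by rw [← eval_evalRight, mem_coneIdeal_iff.mp h v' hv']))
    simp only [mem_coneIdeal_iff, not_forall] at hright
    obtain ⟨s, hs, hfgs⟩ := hright
    rw [map_mul, eval_evalRight, eval_evalRight, mul_eq_zero, not_or] at hfgs
    have hleft : evalLeft s f * evalLeft s g ∉ coneIdeal X₂ :=
      (isPrime_coneIdeal h₂).mul_notMem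
        (fun h => hfgs.1 (by rw [← eval_evalLeft, mem_coneIdeal_iff.mp h w hw]))
        (fun h => hfgs.2 (by rw [← eval_evalLeft, mem_coneIdeal_iff.mp h w' hw']))
    refine hleft (mem_coneIdeal_iff.mpr fun t ht => ?_)
    rw [← map_mul, eval_evalLeft]
    exact mem_conePairIdeal_iff.mp hfg s hs t ht

theorem exists_mem_iff_aeval_eq_zero {k σ : Type*} [Field k] (J : Ideal (MvPolynomial σ k))
    [J.IsPrime] :
    ∃ x : σ → FractionRing (MvPolynomial σ k ⧸ J), ∀ f, f ∈ J ↔ aeval x f = 0 := by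
  refine ⟨algebraMap _ _ ∘ fun i => Ideal.Quotient.mk J (X i), fun f => ?_⟩
  have hmk : aeval (fun i => Ideal.Quotient.mk J (X i)) = Ideal.Quotient.mkₐ k J := by
    ext
    simp
  rw [aeval_algebraMap_apply, map_eq_zero_iff _ (IsFractionRing.injective _ _), hmk,
    Ideal.Quotient.mkₐ_eq_mk, Ideal.Quotient.eq_zero_iff_mem]

/-- The point `(x, y)` with values in a field extension is a generic point of the product of the
cones over `X₁` and `X₂`. -/
def IsGenericPair (X₁ : Set (ProjSpace ι)) (X₂ : Set (ProjSpace κ)) (x : ι → F) (y : κ → F) :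
    Prop :=
  ∀ f, f ∈ conePairIdeal X₁ X₂ ↔ aeval (Sum.elim x y) f = 0

theorem exists_isGenericPair (h₁ : IsPreirreducible X₁) (h₂ : IsPreirreducible X₂) :
    ∃ (F : Type) (_ : Field F) (_ : Algebra ℂ F) (x : ι → F) (y : κ → F),
      IsGenericPair X₁ X₂ x y := by
  have := isPrime_conePairIdeal h₁ h₂
  obtain ⟨z, hz⟩ := exists_mem_iff_aeval_eq_zero (conePairIdeal X₁ X₂)
  refine ⟨_, inferInstance, inferInstance, z ∘ Sum.inl, z ∘ Sum.inr, fun f => ?_⟩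
  rw [Sum.elim_comp_inl_inr]
  exact hz f

theorem IsGenericPair.left (h : IsGenericPair X₁ X₂ x y) : IsGenericPoint X₁ x := by
  intro f
  have hf := h (rename Sum.inl f)
  rw [aeval_rename, Sum.elim_comp_inl, mem_conePairIdeal_iff] at hf
  rw [← hf, mem_coneIdeal_iff]
  simp only [eval_rename, Sum.elim_comp_inl]
  exact forall₂_congr fun v _ => ⟨fun h _ _ => h, fun h => h 0 fun h0 => absurd rfl h0⟩

theorem IsGenericPair.symm (h : IsGenericPair X₁ X₂ x y) : IsGenericPair X₂ X₁ y x := by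
  intro f
  have hf := h (rename Sum.swap f)
  simp only [mem_conePairIdeal_iff, aeval_rename, eval_rename, Sum.elim_swap] at hf
  rw [← hf, mem_conePairIdeal_iff]
  exact ⟨fun h v hv w hw => h w hw v hv, fun h v hv w hw => h w hw v hv⟩

theorem IsGenericPair.right (h : IsGenericPair X₁ X₂ x y) : IsGenericPoint X₂ y :=
  h.symm.left

theorem exists_eq_sum_smul_map {k L B σ : Type*} [Field k] [Field L] [Algebra k L]
    (b : Module.Basis B k L) (h : MvPolynomial σ L) :
    ∃ g : B →₀ MvPolynomial σ k, h = g.sum fun l p => b l • map (algebraMap k L) p := by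
  induction h using MvPolynomial.induction_on' with
  | monomial u a =>
    refine ⟨(b.repr a).mapRange (monomial u) (map_zero _), ?_⟩
    rw [Finsupp.sum_mapRange_index (by simp)]
    conv_lhs => rw [← b.linearCombination_repr a, Finsupp.linearCombination_apply]
    simp [Finsupp.sum, smul_monomial, smul_eq_mul, Algebra.smul_def (A := L), mul_comm]
  | add p q hp hq =>
    obtain ⟨g, rfl⟩ := hp
    obtain ⟨g', rfl⟩ := hq
    classical
    exact ⟨g + g', (Finsupp.sum_add_index' (by simp) (by simp)).symm⟩

theorem IsGenericPoint.eval_eq_zero (hy : IsGenericPoint X₂ y) {h : MvPolynomial κ F}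
    (hh : ∀ w ∈ cone X₂, eval (algebraMap ℂ F ∘ w) h = 0) : eval y h = 0 := by
  let b := Module.Basis.ofVectorSpace ℂ F
  obtain ⟨g, rfl⟩ := exists_eq_sum_smul_map b h
  have hg (l) : g l ∈ coneIdeal X₂ := by
    refine mem_coneIdeal_iff.mpr fun w hw => ?_
    have hzero : Finsupp.linearCombination ℂ b (g.mapRange (eval w) (map_zero _)) = 0 := by
      rw [Finsupp.linearCombination_apply, Finsupp.sum_mapRange_index (by simp), ← hh w hw]
      simp [Finsupp.sum, Algebra.smul_def, mul_comm, eval₂_comp]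
    simpa using DFunLike.congr_fun (linearIndependent_iff.mp b.linearIndependent _ hzero) l
  rw [Finsupp.sum, map_sum]
  refine Finset.sum_eq_zero fun l _ => ?_
  rw [smul_eval, eval_map, ← aeval_def, (hy _).mp (hg l), mul_zero]

theorem IsGenericPair.elim_zero_mem_tangentSpace [Finite ι] [Finite κ]
    (h : IsGenericPair X₁ X₂ x y) {u : ι → F} (hu : u ∈ tangentSpace ℂ x) :
    Sum.elim u (0 : κ → F) ∈ tangentSpace ℂ (Sum.elim x y) := by
  have := Fintype.ofFinite ι
  have := Fintype.ofFinite κ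
  obtain ⟨D, rfl⟩ := hu
  rw [mem_tangentSpace_iff]
  intro f hf
  let θ : MvPolynomial (ι ⊕ κ) ℂ →ₐ[ℂ] MvPolynomial κ F := aeval (Sum.elim (fun i => C (x i)) X)
  have hθ (w : κ → F) (g) : eval w (θ g) = aeval (Sum.elim x w) g := by
    let φ : MvPolynomial κ F →ₐ[F] F := aeval w
    have : φ ∘ Sum.elim (fun i => C (x i)) X = Sum.elim x w := by
      ext (i | j) <;> simp [φ]
    rw [← this, ← aeval_eq_eval]
    exact comp_aeval_apply _ (φ.restrictScalars ℂ) g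
  -- the derivative of `f` in the direction `(u, 0)`, as a polynomial in the second variables
  let h₁ : MvPolynomial κ F := ∑ i, C (D (x i)) * θ (pderiv (Sum.inl i) f)
  have hgrad (w : κ → F) : eval w h₁ =
      grad f (Sum.elim x w) ⬝ᵥ Sum.elim (evalDer ℂ x D) 0 := by
    simp [h₁, hθ, dotProduct, grad, evalDer, mul_comm]
  rw [← hgrad]
  refine h.right.eval_eq_zero fun w hw => ?_
  have hfw : aeval (Sum.elim x (algebraMap ℂ F ∘ w)) f = 0 := by
    rw [← aeval_evalRight, ← h.left]
    exact evalRight_mem_coneIdeal ((h f).mpr hf) hw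
  have hD := derivation_aeval D (Sum.elim x (algebraMap ℂ F ∘ w)) f
  rw [hfw, map_zero] at hD
  rw [hgrad, hD]
  congr 1
  ext (i | j) <;> simp [evalDer]

theorem IsGenericPair.exists_derivation [Finite ι] [Finite κ] (h : IsGenericPair X₁ X₂ x y)
    {u : ι → F} (hu : u ∈ tangentSpace ℂ x) :
    ∃ D : Derivation ℂ F F, evalDer ℂ x D = u ∧ evalDer ℂ y D = 0 := by
  obtain ⟨D, hD⟩ := h.elim_zero_mem_tangentSpace hu
  exact ⟨D, congrArg (· ∘ Sum.inl) hD, congrArg (· ∘ Sum.inr) hD⟩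

end GenericPair

section Segre

variable {ι κ : Type} {X₁ : Set (ProjSpace ι)} {X₂ : Set (ProjSpace κ)}

/-- The tensor product of two vectors. -/
def tensor {ι κ R : Type*} [Mul R] (v : ι → R) (w : κ → R) : ι × κ → R :=
  fun p => v p.1 * w p.2

theorem tensor_mem_cone_segreProduct {v : ι → ℂ} {w : κ → ℂ} (hv : v ∈ cone X₁)
    (hw : w ∈ cone X₂) : tensor v w ∈ cone (segreProduct X₁ X₂) := by
  intro h0
  have hv0 : v ≠ 0 := by
    rintro rfl
    exact h0 (funext fun _ => zero_mul _)
  have hw0 : w ≠ 0 := by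
    rintro rfl
    exact h0 (funext fun _ => mul_zero _)
  obtain ⟨a, ha⟩ := Projectivization.exists_smul_eq_mk_rep ℂ v hv0
  obtain ⟨b, hb⟩ := Projectivization.exists_smul_eq_mk_rep ℂ w hw0
  refine ⟨_, hv hv0, _, hw hw0, ?_⟩
  rw [segre, Projectivization.mk_eq_mk_iff']
  refine ⟨a * b, funext fun p => ?_⟩
  rw [← ha, ← hb]
  simp only [tensor, Pi.smul_apply, Units.smul_def, smul_eq_mul]
  ring

theorem mem_cone_segreProduct_iff {u : ι × κ → ℂ} :
    u ∈ cone (segreProduct X₁ X₂) ↔ ∃ v ∈ cone X₁, ∃ w ∈ cone X₂, tensor v w = u := by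
  refine ⟨fun hu => ?_, ?_⟩
  · by_cases hu0 : u = 0
    · exact ⟨0, fun h => absurd rfl h, 0, fun h => absurd rfl h, hu0 ▸ funext fun _ => zero_mul _⟩
    · obtain ⟨p, hp, q, hq, hpq⟩ := hu hu0
      obtain ⟨a, ha⟩ := (Projectivization.mk_eq_mk_iff' ..).mp hpq.symm
      refine ⟨a • p.rep, smul_mem_cone (rep_mem_cone_iff.mpr hp) a, q.rep,
        rep_mem_cone_iff.mpr hq, ?_⟩
      rw [← ha]
      exact funext fun _ => mul_assoc ..
  · rintro ⟨v, hv, w, hw, rfl⟩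
    exact tensor_mem_cone_segreProduct hv hw

theorem mem_cone_of_forall_eval_eq_zero [Finite ι] {Z : Set (ProjSpace ι)} (hZ : IsClosed Z)
    {v : ι → ℂ} (h : ∀ f ∈ coneIdeal Z, eval v f = 0) : v ∈ cone Z := by
  intro hv
  obtain ⟨a, ha⟩ := Projectivization.exists_smul_eq_mk_rep ℂ v hv
  refine mem_of_forall_eval_rep_eq_zero hZ fun f hf => ?_
  rw [← ha, Units.smul_def, ← sum_homogeneousComponent f, map_sum]
  refine Finset.sum_eq_zero fun n _ => ?_
  rw [eval_smul_of_isHomogeneous (homogeneousComponent_isHomogeneous n f),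
    h _ (homogeneousComponent_mem_coneIdeal hf n), mul_zero]

theorem comp_mem_cone_of_mem_cone_closure {σ : Type} [Finite σ] {X : Set (ProjSpace σ)}
    (hX : IsClosed X) {Z : Set (ProjSpace ι)} {φ : σ → ι} (h : ∀ u ∈ cone Z, u ∘ φ ∈ cone X)
    {u : ι → ℂ} (hu : u ∈ cone (closure Z)) : u ∘ φ ∈ cone X := by
  refine mem_cone_of_forall_eval_eq_zero hX fun f hf => ?_
  have hrename : rename φ f ∈ coneIdeal (closure Z) := by
    rw [coneIdeal_closure, mem_coneIdeal_iff]
    intro u hu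
    rw [eval_rename, mem_coneIdeal_iff.mp hf _ (h u hu)]
  rw [← eval_rename, mem_coneIdeal_iff.mp hrename u hu]

theorem mul_eq_mul_of_mem_cone_closure_segreProduct {u : ι × κ → ℂ}
    (hu : u ∈ cone (closure (segreProduct X₁ X₂))) (i i₀ : ι) (j j₀ : κ) :
    u (i, j) * u (i₀, j₀) = u (i, j₀) * u (i₀, j) := by
  have hminor : X (i, j) * X (i₀, j₀) - X (i, j₀) * X (i₀, j) ∈
      coneIdeal (closure (segreProduct X₁ X₂)) := by
    rw [coneIdeal_closure, mem_coneIdeal_iff]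
    intro u hu
    obtain ⟨v, -, w, -, rfl⟩ := mem_cone_segreProduct_iff.mp hu
    simp only [tensor, map_sub, map_mul, eval_X]
    ring
  simpa [sub_eq_zero] using mem_coneIdeal_iff.mp hminor u hu

theorem isClosed_segreProduct [Finite ι] [Finite κ] (h₁ : IsClosed X₁) (h₂ : IsClosed X₂) :
    IsClosed (segreProduct X₁ X₂) := by
  refine isClosed_of_closure_subset fun p hp => ?_
  have hu := rep_mem_cone_iff.mpr hp
  obtain ⟨⟨i₀, j₀⟩, h0 : p.rep (i₀, j₀) ≠ 0⟩ := Function.ne_iff.mp p.rep_nonzero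
  have hcol : p.rep ∘ (·, j₀) ∈ cone X₁ := by
    refine comp_mem_cone_of_mem_cone_closure h₁ (fun u hu => ?_) hu
    obtain ⟨v, hv, w, -, rfl⟩ := mem_cone_segreProduct_iff.mp hu
    convert smul_mem_cone hv (w j₀) using 1
    exact funext fun i => mul_comm ..
  have hrow : p.rep ∘ (i₀, ·) ∈ cone X₂ := by
    refine comp_mem_cone_of_mem_cone_closure h₂ (fun u hu => ?_) hu
    obtain ⟨v, -, w, hw, rfl⟩ := mem_cone_segreProduct_iff.mp hu
    exact smul_mem_cone hw (v i₀)
  rw [← rep_mem_cone_iff, mem_cone_segreProduct_iff]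
  refine ⟨_, smul_mem_cone hcol (p.rep (i₀, j₀))⁻¹, _, hrow, funext fun ⟨i, j⟩ => ?_⟩
  simp only [tensor, Pi.smul_apply, Function.comp_apply, smul_eq_mul, mul_assoc]
  rw [← mul_eq_mul_of_mem_cone_closure_segreProduct hu, mul_comm, mul_inv_cancel_right₀ h0]

theorem aeval_elim_aeval_tensor {L : Type*} [Field L] [Algebra ℂ L] (v : ι → L) (w : κ → L)
    (f : MvPolynomial (ι × κ) ℂ) :
    aeval (Sum.elim v w) (aeval (tensor (X ∘ Sum.inl) (X ∘ Sum.inr)) f : MvPolynomial _ ℂ) =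
      aeval (tensor v w) f := by
  rw [← AlgHom.comp_apply, comp_aeval]
  congr 2
  ext p
  simp [tensor]

theorem IsGenericPair.isGenericPoint_tensor {F : Type*} [Field F] [Algebra ℂ F] {x : ι → F}
    {y : κ → F} (h : IsGenericPair X₁ X₂ x y) :
    IsGenericPoint (segreProduct X₁ X₂) (tensor x y) := by
  intro f
  rw [← aeval_elim_aeval_tensor, ← h, mem_conePairIdeal_iff, mem_coneIdeal_iff]
  refine ⟨fun h v hv w hw => ?_, fun h u hu => ?_⟩
  · exact (aeval_elim_aeval_tensor v w f).trans (h _ (tensor_mem_cone_segreProduct hv hw))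
  · obtain ⟨v, hv, w, hw, rfl⟩ := mem_cone_segreProduct_iff.mp hu
    exact (aeval_elim_aeval_tensor v w f).symm.trans (h v hv w hw)

end Segre

/-! ### The second fundamental form of a Segre product -/

section DualFamily

variable {ι A K : Type*} [Field K]

theorem exists_linearIndependent_option {V : Type*} [AddCommGroup V] [Module K V]
    [FiniteDimensional K V] {W : Submodule K V} {x : V} (hx : x ≠ 0) (hxW : x ∈ W) :
    ∃ (m : ℕ) (b : Fin m → V), LinearIndependent K (Option.elim' x b) ∧
      Submodule.span K (insert x (Set.range b)) = W := by
  obtain ⟨C, hC⟩ := Submodule.exists_isCompl (Submodule.span K {x})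
  obtain ⟨m, b, hb, hspan⟩ := exists_linearIndependent_span_eq (C ⊓ W)
  refine ⟨m, b, linearIndependent_option.mpr ⟨hb, fun hxb => hx ?_⟩, ?_⟩
  · exact Submodule.disjoint_def.mp hC.disjoint x (Submodule.mem_span_singleton_self x)
      (hspan.le.trans inf_le_left hxb)
  · rw [Submodule.span_insert, hspan, ← sup_inf_assoc_of_le _ (by simpa using hxW),
      hC.sup_eq_top, top_inf_eq]

theorem finrank_span_insert_range [Fintype A] {V : Type*} [AddCommGroup V] [Module K V]
    {x : V} {b : A → V} (h : LinearIndependent K (Option.elim' x b)) :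
    Module.finrank K (Submodule.span K (insert x (Set.range b))) = Fintype.card A + 1 := by
  have hrange : Set.range (Option.elim' x b) = insert x (Set.range b) := Option.range_eq _
  rw [← hrange, finrank_span_eq_card h, Fintype.card_option]

variable [Fintype ι] [DecidableEq A]

theorem exists_dotProduct_eq_one_apply {v : A → ι → K} (hv : LinearIndependent K v) :
    ∃ v' : A → ι → K, ∀ a c, v' a ⬝ᵥ v c = (1 : Matrix A A K) a c := by
  classical
  obtain ⟨f, hf⟩ := (Finsupp.linearCombination K v).exists_leftInverse_of_injective
    (linearIndependent_iff_ker.mp hv)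
  refine ⟨fun a => (dotProductEquiv K ι).symm (Finsupp.lapply a ∘ₗ f), fun a c => ?_⟩
  have hc : f (v c) = Finsupp.single c 1 := by
    simpa using LinearMap.congr_fun hf (Finsupp.single c 1)
  rw [← dotProductEquiv_apply_apply, LinearEquiv.apply_symm_apply, LinearMap.comp_apply, hc,
    Finsupp.lapply_apply, Finsupp.single_apply, Matrix.one_apply]
  simp only [eq_comm]

theorem linearIndependent_of_dotProduct_eq_one_apply {v v' : A → ι → K}
    (h : ∀ a c, v' a ⬝ᵥ v c = (1 : Matrix A A K) a c) : LinearIndependent K v := by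
  rw [linearIndependent_iff']
  intro s g hg a ha
  simpa [dotProduct_sum, h, ha, Matrix.one_apply] using congrArg (v' a ⬝ᵥ ·) hg

end DualFamily

section Tensor

variable {ι κ A B K : Type*} [Field K]

theorem uncurry_dotProduct_tensor [Fintype ι] [Fintype κ] (M : Matrix ι κ K) (v : ι → K)
    (w : κ → K) : Function.uncurry M ⬝ᵥ tensor v w = v ⬝ᵥ M *ᵥ w := by
  simp only [dotProduct, tensor, Matrix.mulVec, Fintype.sum_prod_type, Finset.mul_sum,
    Function.uncurry]
  exact Finset.sum_congr rfl fun i _ => Finset.sum_congr rfl fun j _ => by ring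

theorem tensor_dotProduct_tensor [Fintype ι] [Fintype κ] (s v : ι → K) (t w : κ → K) :
    tensor s t ⬝ᵥ tensor v w = (s ⬝ᵥ v) * (t ⬝ᵥ w) := by
  change Function.uncurry (Matrix.vecMulVec s t) ⬝ᵥ tensor v w = _
  rw [uncurry_dotProduct_tensor, Matrix.vecMulVec_mulVec]
  simp [dotProduct_comm v, mul_comm]

variable {x : ι → K} {d : A → ι → K} {y : κ → K} {e : B → κ → K}

theorem linearIndependent_tensor [Finite ι] [Finite κ]
    (hd : LinearIndependent K (Option.elim' x d)) (he : LinearIndependent K (Option.elim' y e)) :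
    LinearIndependent K (Option.elim' (tensor x y)
      (Sum.elim (fun a => tensor (d a) y) fun b => tensor x (e b))) := by
  classical
  have := Fintype.ofFinite ι
  have := Fintype.ofFinite κ
  obtain ⟨d', hd'⟩ := exists_dotProduct_eq_one_apply hd
  obtain ⟨e', he'⟩ := exists_dotProduct_eq_one_apply he
  simp only [Option.forall, Option.elim'_none, Option.elim'_some] at hd' he'
  refine linearIndependent_of_dotProduct_eq_one_apply (v' := Option.elim' (tensor (d' none)
    (e' none)) (Sum.elim (fun a => tensor (d' (some a)) (e' none)) fun b =>
      tensor (d' none) (e' (some b)))) ?_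
  rintro (_ | a | b) (_ | a' | b') <;>
    simp [tensor_dotProduct_tensor, hd', he', Matrix.one_apply]

theorem exists_matrix_of_linearIndependent [Fintype ι] [Fintype κ] [Finite A] [Finite B]
    (hd : LinearIndependent K (Option.elim' x d)) (he : LinearIndependent K (Option.elim' y e))
    {ξ : ι → K} (hξ : ξ ∈ perp (Submodule.span K (insert x (Set.range d)))) {η : κ → K}
    (hη : η ∈ perp (Submodule.span K (insert y (Set.range e)))) (C : Matrix A B K) :
    ∃ M : Matrix ι κ K, M *ᵥ y = ξ ∧ x ᵥ* M = η ∧ ∀ a b, d a ⬝ᵥ M *ᵥ e b = C a b := by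
  classical
  have := Fintype.ofFinite A
  have := Fintype.ofFinite B
  obtain ⟨d', hd'⟩ := exists_dotProduct_eq_one_apply hd
  obtain ⟨e', he'⟩ := exists_dotProduct_eq_one_apply he
  simp only [Option.forall, Option.elim'_none, Option.elim'_some] at hd' he'
  simp only [mem_perp_span, Set.forall_mem_insert, Set.forall_mem_range] at hξ hη
  let P := Matrix.of fun a => d' (some a)
  let Q := Matrix.of fun b => e' (some b)
  have hPx : P *ᵥ x = 0 := funext fun a => by simp [P, Matrix.mulVec, hd']
  have hPd (a) : P *ᵥ d a = Pi.single a 1 := funext fun c => by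
    simp [P, Matrix.mulVec, hd', Matrix.one_apply, Pi.single_apply]
  have hQy : Q *ᵥ y = 0 := funext fun b => by simp [Q, Matrix.mulVec, he']
  have hQe (b) : Q *ᵥ e b = Pi.single b 1 := funext fun c => by
    simp [Q, Matrix.mulVec, he', Matrix.one_apply, Pi.single_apply]
  refine ⟨Matrix.vecMulVec ξ (e' none) + Matrix.vecMulVec (d' none) η + Pᵀ * C * Q, ?_, ?_,
    fun a b => ?_⟩
  · simp [Matrix.add_mulVec, Matrix.vecMulVec_mulVec, ← Matrix.mulVec_mulVec, hQy, he', hη.1]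
  · simp [Matrix.vecMul_add, Matrix.vecMul_vecMulVec, ← Matrix.vecMul_vecMul,
      Matrix.vecMul_transpose, hPx, hd', dotProduct_comm x, hξ.1]
  · have hC : d a ⬝ᵥ (Pᵀ * C * Q) *ᵥ e b = C a b := by
      rw [← Matrix.mulVec_mulVec, ← Matrix.mulVec_mulVec, hQe, Matrix.dotProduct_mulVec,
        Matrix.vecMul_transpose, hPd, Matrix.mulVec_single_one, single_one_dotProduct,
        Matrix.col_apply]
    rw [Matrix.add_mulVec, dotProduct_add, hC]
    simp [Matrix.add_mulVec, Matrix.vecMulVec_mulVec, dotProduct_comm (d a), hξ.2, hη.2]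

end Tensor

section SegreProduct

variable {k ι κ A B F : Type*} [Field k] [Field F] [Algebra k F] {x : ι → F} {y : κ → F}

theorem evalDer_tensor (x : ι → F) (y : κ → F) (D : Derivation k F F) :
    evalDer k (tensor x y) D = tensor (evalDer k x D) y + tensor x (evalDer k y D) := by
  ext p
  simp [evalDer, tensor, mul_comm, add_comm]

theorem secondForm_tensor [Fintype ι] [Fintype κ] {D : A → Derivation k F F}
    (hD : ∀ a, evalDer k y (D a) = 0)
    {E : B → Derivation k F F} (hE : ∀ b, evalDer k x (E b) = 0) {M : Matrix ι κ F}
    (hM : Function.uncurry M ∈ perp (tangentSpace k (tensor x y)))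
    (hMx : x ᵥ* M ∈ perp (tangentSpace k y)) :
    secondForm (Sum.elim D E) (tensor x y) (Function.uncurry M) =
      Matrix.fromBlocks (secondForm D x (M *ᵥ y))
        (Matrix.of fun a b => evalDer k x (D a) ⬝ᵥ M *ᵥ evalDer k y (E b))
        (Matrix.of fun a b => evalDer k x (D a) ⬝ᵥ M *ᵥ evalDer k y (E b))ᵀ
        (secondForm E y (x ᵥ* M)) := by
  have htensor (v : ι → F) : tensor v (0 : κ → F) = 0 := funext fun _ => mul_zero _
  have htensor' (w : κ → F) : tensor (0 : ι → F) w = 0 := funext fun _ => zero_mul _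
  have hmixed (a b) : secondForm (Sum.elim D E) (tensor x y) (Function.uncurry M) (Sum.inl a)
      (Sum.inr b) = evalDer k x (D a) ⬝ᵥ M *ᵥ evalDer k y (E b) := by
    have hcomm : evalDer k (evalDer k y (E b)) (D a) = evalDer k y ⁅D a, E b⁆ := by
      ext j
      have hDj : D a (y j) = 0 := congrFun (hD a) j
      simp [evalDer, Derivation.commutator_apply, hDj]
    rw [secondForm_apply, Sum.elim_inl, Sum.elim_inr, evalDer_tensor, hE, htensor', zero_add,
      evalDer_tensor, hcomm, dotProduct_add, uncurry_dotProduct_tensor, uncurry_dotProduct_tensor,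
      Matrix.dotProduct_mulVec x, dotProduct_evalDer_eq_zero hMx, add_zero]
  ext (a | b) (a' | b')
  · simp [secondForm_apply, evalDer_tensor, hD, htensor, uncurry_dotProduct_tensor,
      dotProduct_comm (M *ᵥ y)]
  · exact hmixed a b'
  · exact ((isSymm_secondForm hM _).apply _ _).trans (hmixed a' b)
  · simp [secondForm_apply, evalDer_tensor, hE, htensor', uncurry_dotProduct_tensor,
      Matrix.dotProduct_mulVec]

end SegreProduct

section GenericPair

variable {ι κ : Type} {A B F : Type*} [Field F] [Algebra ℂ F] {x : ι → F} {y : κ → F}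
  {X₁ : Set (ProjSpace ι)} {X₂ : Set (ProjSpace κ)}

/-- A family of derivations which do not move `y`, and which move `x` along vectors that form,
together with `x`, a basis of the tangent space at `x`. -/
structure IsPartialFrame (x : ι → F) (y : κ → F) (D : A → Derivation ℂ F F) : Prop where
  evalDer_eq_zero : ∀ a, evalDer ℂ y (D a) = 0
  linearIndependent : LinearIndependent F (Option.elim' x fun a => evalDer ℂ x (D a))
  span_eq : Submodule.span F (insert x (Set.range fun a => evalDer ℂ x (D a))) = tangentSpace ℂ x

theorem IsGenericPair.exists_isPartialFrame [Finite ι] [Finite κ] (h : IsGenericPair X₁ X₂ x y)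
    (hne : X₁.Nonempty) : ∃ (m : ℕ) (D : Fin m → Derivation ℂ F F), IsPartialFrame x y D := by
  have hx : x ≠ 0 := fun hx => hne.ne_empty (h.left.eq_zero_iff.mp hx)
  obtain ⟨m, b, hb, hspan⟩ := exists_linearIndependent_option hx h.left.self_mem_tangentSpace
  have hmem (a) : b a ∈ tangentSpace ℂ x := hspan.le (Submodule.subset_span (by simp))
  choose D hDx hDy using fun a => h.exists_derivation (hmem a)
  obtain rfl : (fun a => evalDer ℂ x (D a)) = b := funext hDx
  exact ⟨m, D, hDy, hb, hspan⟩

theorem IsPartialFrame.finrank_tangentSpace [Fintype A] {D : A → Derivation ℂ F F}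
    (hD : IsPartialFrame x y D) :
    Module.finrank F (tangentSpace ℂ x) = Fintype.card A + 1 := by
  rw [← hD.span_eq, finrank_span_insert_range hD.linearIndependent]

theorem IsGenericPair.uncurry_mem_perp_tangentSpace_iff [Fintype ι] [Fintype κ]
    (h : IsGenericPair X₁ X₂ x y) {M : Matrix ι κ F} :
    Function.uncurry M ∈ perp (tangentSpace ℂ (tensor x y)) ↔
      M *ᵥ y ∈ perp (tangentSpace ℂ x) ∧ x ᵥ* M ∈ perp (tangentSpace ℂ y) := by
  have hpair (D : Derivation ℂ F F) : Function.uncurry M ⬝ᵥ evalDer ℂ (tensor x y) D =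
      M *ᵥ y ⬝ᵥ evalDer ℂ x D + x ᵥ* M ⬝ᵥ evalDer ℂ y D := by
    rw [evalDer_tensor, dotProduct_add, uncurry_dotProduct_tensor, uncurry_dotProduct_tensor,
      dotProduct_comm (M *ᵥ y), Matrix.dotProduct_mulVec x]
  refine ⟨fun hM => ⟨mem_perp.mpr fun u hu => ?_, mem_perp.mpr fun w hw => ?_⟩, fun hM => ?_⟩
  · obtain ⟨D, rfl, hDy⟩ := h.exists_derivation hu
    simpa [hpair, hDy] using dotProduct_evalDer_eq_zero hM D
  · obtain ⟨D, rfl, hDx⟩ := h.symm.exists_derivation hw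
    simpa [hpair, hDx] using dotProduct_evalDer_eq_zero hM D
  · refine mem_perp.mpr ?_
    rintro _ ⟨D, rfl⟩
    rw [hpair, dotProduct_evalDer_eq_zero hM.1, dotProduct_evalDer_eq_zero hM.2, add_zero]

variable {D : A → Derivation ℂ F F} {E : B → Derivation ℂ F F}

theorem IsPartialFrame.evalDer_tensor (hD : IsPartialFrame x y D) (hE : IsPartialFrame y x E) :
    (fun c => evalDer ℂ (tensor x y) (Sum.elim D E c)) =
      Sum.elim (fun a => tensor (evalDer ℂ x (D a)) y) fun b => tensor x (evalDer ℂ y (E b)) := by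
  ext (a | b) p <;>
    simp [ProjDual.evalDer_tensor, hD.evalDer_eq_zero, hE.evalDer_eq_zero, tensor]

theorem IsGenericPair.span_insert_tensor [Finite ι] [Finite κ] (h : IsGenericPair X₁ X₂ x y)
    (hD : IsPartialFrame x y D) (hE : IsPartialFrame y x E) :
    Submodule.span F (insert (tensor x y)
        (Set.range fun c => evalDer ℂ (tensor x y) (Sum.elim D E c))) =
      tangentSpace ℂ (tensor x y) := by
  have := Fintype.ofFinite ι
  have := Fintype.ofFinite κ
  rw [hD.evalDer_tensor hE, ← perp_perp (Submodule.span F _), ← perp_perp (tangentSpace _ _)]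
  congr 1
  ext ξ
  obtain ⟨M, rfl⟩ : ∃ M : Matrix ι κ F, Function.uncurry M = ξ := ⟨_, Function.uncurry_curry ξ⟩
  rw [h.uncurry_mem_perp_tangentSpace_iff, ← hD.span_eq, ← hE.span_eq]
  simp only [mem_perp_span, Set.forall_mem_insert, Set.forall_mem_range, Sum.forall, Sum.elim_inl,
    Sum.elim_inr, uncurry_dotProduct_tensor, dotProduct_comm (M *ᵥ y), ← Matrix.dotProduct_mulVec]
  tauto

theorem IsPartialFrame.linearIndependent_tensor [Finite ι] [Finite κ] (hD : IsPartialFrame x y D)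
    (hE : IsPartialFrame y x E) :
    LinearIndependent F (Option.elim' (tensor x y)
      fun c => evalDer ℂ (tensor x y) (Sum.elim D E c)) := by
  rw [hD.evalDer_tensor hE]
  exact ProjDual.linearIndependent_tensor hD.linearIndependent hE.linearIndependent

variable [Fintype ι] [Fintype κ] [Fintype A] [Fintype B]

theorem IsGenericPair.mem_secondRanks_tensor_iff (h : IsGenericPair X₁ X₂ x y)
    (hD : IsPartialFrame x y D) (hE : IsPartialFrame y x E) {r : ℕ} :
    r ∈ secondRanks (k := ℂ) (Sum.elim D E) (tensor x y) ↔
      ∃ ξ ∈ perp (tangentSpace ℂ x), ∃ η ∈ perp (tangentSpace ℂ y), ∃ C : Matrix A B F,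
        (Matrix.fromBlocks (secondForm D x ξ) C Cᵀ (secondForm E y η)).rank = r := by
  constructor
  · rintro ⟨ζ, hζ, rfl⟩
    obtain ⟨M, rfl⟩ : ∃ M : Matrix ι κ F, Function.uncurry M = ζ := ⟨_, Function.uncurry_curry ζ⟩
    obtain ⟨hξ, hη⟩ := h.uncurry_mem_perp_tangentSpace_iff.mp hζ
    exact ⟨_, hξ, _, hη, _, congrArg Matrix.rank
      (secondForm_tensor hD.evalDer_eq_zero hE.evalDer_eq_zero hζ hη).symm⟩
  · rintro ⟨ξ, hξ, η, hη, C, rfl⟩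
    obtain ⟨M, rfl, rfl, hC⟩ := exists_matrix_of_linearIndependent hD.linearIndependent
      hE.linearIndependent (hD.span_eq ▸ hξ) (hE.span_eq ▸ hη) C
    have hM := h.uncurry_mem_perp_tangentSpace_iff.mpr ⟨hξ, hη⟩
    obtain rfl : (Matrix.of fun a b => evalDer ℂ x (D a) ⬝ᵥ M *ᵥ evalDer ℂ y (E b)) = C :=
      Matrix.ext hC
    exact ⟨_, hM, congrArg Matrix.rank
      (secondForm_tensor hD.evalDer_eq_zero hE.evalDer_eq_zero hM hη)⟩

variable {r₁ r₂ : ℕ}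

theorem IsGenericPair.le_of_mem_secondRanks_tensor (h : IsGenericPair X₁ X₂ x y)
    (hD : IsPartialFrame x y D) (hE : IsPartialFrame y x E)
    (hr₁ : IsGreatest (secondRanks D x) r₁) (hr₂ : IsGreatest (secondRanks E y) r₂) {r : ℕ}
    (hr : r ∈ secondRanks (k := ℂ) (Sum.elim D E) (tensor x y)) :
    r ≤ min (Fintype.card A + Fintype.card B)
      (min (r₁ + 2 * Fintype.card B) (r₂ + 2 * Fintype.card A)) := by
  obtain ⟨ξ, hξ, η, hη, C, rfl⟩ := (h.mem_secondRanks_tensor_iff hD hE).mp hr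
  refine le_min ((Matrix.rank_le_card_width _).trans_eq Fintype.card_sum) (le_min ?_ ?_)
  · exact (rank_fromBlocks_le ..).trans (by gcongr; exact hr₁.2 ⟨ξ, hξ, rfl⟩)
  · rw [rank_fromBlocks_swap]
    exact (rank_fromBlocks_le ..).trans (by gcongr; exact hr₂.2 ⟨η, hη, rfl⟩)

theorem IsGenericPair.exists_le_mem_secondRanks_tensor (h : IsGenericPair X₁ X₂ x y)
    (hD : IsPartialFrame x y D) (hE : IsPartialFrame y x E)
    (hr₁ : r₁ ∈ secondRanks D x) (hr₂ : r₂ ∈ secondRanks E y) :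
    ∃ r ∈ secondRanks (k := ℂ) (Sum.elim D E) (tensor x y),
      min (Fintype.card A + Fintype.card B)
        (min (r₁ + 2 * Fintype.card B) (r₂ + 2 * Fintype.card A)) ≤ r := by
  have : CharZero F := charZero_of_injective_algebraMap (algebraMap ℂ F).injective
  obtain ⟨ξ, hξ, rfl⟩ := hr₁
  obtain ⟨η, hη, rfl⟩ := hr₂
  obtain hAB | hBA := le_total (Fintype.card A) (Fintype.card B)
  · obtain ⟨C, hC⟩ := exists_min_le_rank_fromBlocks (isSymm_secondForm hη E) hAB
    refine ⟨_, (h.mem_secondRanks_tensor_iff hD hE).mpr ⟨0, zero_mem _, η, hη, C, rfl⟩, ?_⟩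
    rw [map_zero]
    exact (min_le_min_left _ (min_le_right _ _)).trans hC
  · obtain ⟨C, hC⟩ := exists_min_le_rank_fromBlocks (isSymm_secondForm hξ D) hBA
    refine ⟨_, (h.mem_secondRanks_tensor_iff hD hE).mpr ⟨ξ, hξ, 0, zero_mem _, Cᵀ, rfl⟩, ?_⟩
    rw [map_zero, rank_fromBlocks_swap, Matrix.transpose_transpose, add_comm (Fintype.card A)]
    exact (min_le_min_left _ (min_le_left _ _)).trans hC

theorem IsGenericPair.isGreatest_secondRanks_tensor (h : IsGenericPair X₁ X₂ x y)
    (hD : IsPartialFrame x y D) (hE : IsPartialFrame y x E)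
    (hr₁ : IsGreatest (secondRanks D x) r₁) (hr₂ : IsGreatest (secondRanks E y) r₂) :
    IsGreatest (secondRanks (k := ℂ) (Sum.elim D E) (tensor x y))
      (min (Fintype.card A + Fintype.card B)
        (min (r₁ + 2 * Fintype.card B) (r₂ + 2 * Fintype.card A))) := by
  have hupper := fun r => h.le_of_mem_secondRanks_tensor hD hE hr₁ hr₂ (r := r)
  obtain ⟨r, hr, hle⟩ := h.exists_le_mem_secondRanks_tensor hD hE hr₁.1 hr₂.1
  exact ⟨(hupper r hr).antisymm hle ▸ hr, hupper⟩

end GenericPair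

end ProjDual

end

open ProjDual in
theorem theorem6p5_general {ι κ : Type} [Fintype ι] [Fintype κ] {X₁ : Set (ProjSpace ι)}
    {X₂ : Set (ProjSpace κ)} (h₁ : IsIrredProjVariety X₁) (h₂ : IsIrredProjVariety X₂) :
    defect (segreProduct X₁ X₂) = max 0 (max (defect X₁ - dim X₂) (defect X₂ - dim X₁)) := by
  obtain ⟨F, _, _, x, y, h⟩ := exists_isGenericPair h₁.2.2 h₂.2.2
  obtain ⟨m, D, hD⟩ := h.exists_isPartialFrame h₁.2.1
  obtain ⟨n, E, hE⟩ := h.symm.exists_isPartialFrame h₂.2.1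
  obtain ⟨r₁, hr₁⟩ := exists_isGreatest_secondRanks D x
  obtain ⟨r₂, hr₂⟩ := exists_isGreatest_secondRanks E y
  have hclosed := isClosed_segreProduct h₁.1 h₂.1
  have hspan := h.span_insert_tensor hD hE
  have hdim : dim (segreProduct X₁ X₂) = m + n := by
    rw [h.isGenericPoint_tensor.dim_eq hclosed, ← hspan,
      finrank_span_insert_range (hD.linearIndependent_tensor hE)]
    simp
  have hdim₁ : dim X₁ = m := by simp [h.left.dim_eq h₁.1, hD.finrank_tangentSpace]
  have hdim₂ : dim X₂ = n := by simp [h.right.dim_eq h₂.1, hE.finrank_tangentSpace]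
  rw [h.isGenericPoint_tensor.defect_eq hclosed (h₁.2.1.image2 h₂.2.1) hspan
      (h.isGreatest_secondRanks_tensor hD hE hr₁ hr₂),
    h.left.defect_eq h₁.1 h₁.2.1 hD.span_eq hr₁, h.right.defect_eq h₂.1 h₂.2.1 hE.span_eq hr₂,
    hdim, hdim₁, hdim₂, Fintype.card_fin, Fintype.card_fin]
  omega

theorem theorem6p5 (n₁ n₂ : ℕ)
    (X₁ : Set (ProjDual.ProjSpace (Fin (n₁ + 1)))) (X₂ : Set (ProjDual.ProjSpace (Fin (n₂ + 1))))
    (hX₁ : ProjDual.IsIrredProjVariety X₁) (hX₂ : ProjDual.IsIrredProjVariety X₂) :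
    ProjDual.defect (ProjDual.segreProduct X₁ X₂) =
      max 0 (max (ProjDual.defect X₁ - ProjDual.dim X₂)
        (ProjDual.defect X₂ - ProjDual.dim X₁)) :=
  theorem6p5_general hX₁ hX₂
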